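/- \textbf{Setting.} Let $(E,d)$ be a complete separable metric space with Borel $\sigma$-algebra $\mathcal E$, and let $\bar E=E\cup\{\partial\}$ with an adjoined point $\partial$, a set $B\subseteq\bar E$ being measurable iff $B\cap E\in\mathcal E$. Let $(\Omega,\mathcal F,\mathbb P)$ be a probability space and $\theta=(\theta_t)_{t\in\mathbb R}$ a jointly measurable group of maps on $\Omega$ that preserves $\mathbb P$ and is ergodic. A \emph{local RDS} is a measurable map $\varphi:\mathbb R_+\times\Omega\times\bar E\to\bar E$ with $\varphi_0(\omega,\cdot)=\mathrm{Id}$, $\varphi_{t+s}(\omega,x)=\varphi_t(\theta_s\omega,\varphi_s(\omega,x))$ for all $s,t\ge 0$, $\omega$, $x$, with $\varphi_t(\omega,\partial)=\partial$, such that for each $\omega$ the set $D(\omega)=\{(t,x)\in\mathbb R_+\times E:\varphi_t(\omega,x)\in E\}$ is open, $(t,x)\in D(\omega)$ and $0\le s\le t$ imply $(s,x)\in D(\omega)$, and $\varphi_t(\omega,\cdot)$ is continuous at each $x_0\in E$ with $\varphi_t(\omega,x_0)\in E$. It is a \emph{white noise} RDS if there are sub-$\sigma$-algebras $\mathcal F_{s,t}\subseteq\mathcal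 F$, $s\le t$, with $\mathcal F_{t,u}\subseteq\mathcal F_{s,v}$ and $\mathcal F_{s,t}$ independent of $\mathcal F_{u,v}$ for $s\le t\le u\le v$, with $\theta_r^{-1}(\mathcal F_{s,t})=\mathcal F_{s+r,t+r}$, and such that $(\omega,x)\mapsto\varphi_s(\omega,x)$ is $\mathcal F_{0,s}\otimes\mathcal B(\bar E)$-measurable for each $s\ge0$. Let $\mathcal F_0=\sigma(\mathcal F_{s,0}:s\le 0)$. Distances involving $\partial$ are set to $\infty$. \textbf{Notions.} The RDS is \emph{strongly mixing} with limit $\rho$, a probability measure on $E$, if for each $x\in E$ the law of $\varphi_t(\cdot,x)$ converges weakly to $\rho$ as $t\to\infty$ (so that, for each $x$, $\varphi_t(\cdot,x)\in E$ for all $t\ge0$ a.s.). A \emph{statistical equilibrium} of $\rho$ is an $\mathcal F_0$-measurable random probability measure $\mu_\omega$ on $E$ such that for every sequence $t_k\to\infty$, $\varphi_{t_k}(\theta_{-t_k}\omega)\rho\to\mu_\omega$ weakly, $\mathbb P$-a.s. The RDS is \emph{weakly asymptotically stable} on a non-empty open $U\subseteq E$ if there are a deterministic sequence $t_n\uparrow\infty$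 and a measurable $\mathcal M\subseteq\Omega$ with $\mathbb P(\mathcal M)>0$ such that $1_{\mathcal M}\,d(\varphi_{t_n}(\cdot,x),\varphi_{t_n}(\cdot,y))\to0$ in probability for all $x,y\in U$. It is \emph{pointwise strongly swift transitive} if there is $t>0$ such that $\mathbb P\big(\varphi_t(\cdot,\{x^1,x^2\})\subseteq B(y,2d(x^1,x^2))\big)>0$ for all $x^1\ne x^2$ and all $y$ in $E$, where $B(y,r)$ is the open ball. A \emph{weak point attractor} is a family $A(\omega)$ of non-empty subsets of $E$, a.s. compact, with $\omega\mapsto d(x,A(\omega))$ $\mathcal F$-measurable for each $x\in E$, such that $\varphi_t(\omega,A(\omega))=A(\theta_t\omega)$ a.s. for each $t\ge0$ and $d(\varphi_t(\theta_{-t}\omega,x),A(\omega))\to0$ in probability as $t\to\infty$ for each $x\in E$. It is \emph{minimal} if it is a.s. contained in each weak point attractor. \textbf{Theorem.} Let $\varphi$ be a local white noise RDS on $E$ with right-continuous trajectories that is strongly mixing with limit $\rho$, weakly asymptotically stable on some non-empty open $U$ with $\rho(U)>0$, pointwise strongly swift transitive, and such that for all $x,y\in E$ $$\liminf_{t\to\infty}d(\varphi_t(\omega,x),\varphi_t(\omega,y))=0\quad\mathbb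 P\text{-a.s.}$$ Then a statistical equilibrium $\mu_\omega$ of $\rho$ exists, and there is an $\mathcal F_0$-measurable random point $a:\Omega\to E$ such that $A(\omega)=\{a(\omega)\}$ is a minimal weak point attractor and, for every (version of the) statistical equilibrium $\mu_\omega$, $$A(\omega)=\mathrm{supp}(\mu_\omega)=\{a(\omega)\}\quad\mathbb P\text{-a.s.},$$ i.e. weak synchronization holds. -/

import Mathlib

open MeasureTheory ProbabilityTheory Filter Topology Set
open scoped ENNReal NNReal BoundedContinuousFunction

namespace WeakSync

/-- The `σ`-algebra on `Ē = E ∪ {∂}` (modelled by `Option E` with `∂ = none`):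
a set is measurable iff its trace on `E` is measurable. -/
instance instMeasurableSpaceOption {E : Type*} [MeasurableSpace E] : MeasurableSpace (Option E) :=
  MeasurableSpace.map some inferInstance

/-- An ergodic metric dynamical system `(Ω, 𝓕, P, (θ_t)_{t ∈ ℝ})`. -/
structure ErgodicMDS (Ω : Type*) [MeasurableSpace Ω] (P : Measure Ω) where
  θ : ℝ → Ω → Ω
  measurable_θ : Measurable (fun p : ℝ × Ω => θ p.1 p.2)
  θ_zero : ∀ ω, θ 0 ω = ω
  θ_add : ∀ s t ω, θ (s + t) ω = θ s (θ t ω)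
  map_θ : ∀ t, P.map (θ t) = P
  ergodic : ∀ A : Set Ω, MeasurableSet A → (∀ t, θ t ⁻¹' A = A) → P A = 0 ∨ P A = 1

/-- A local random dynamical system on the metric space `E`, as a map
`φ : ℝ≥0 × Ω × Ē → Ē` with `Ē = Option E`, `∂ = none`. The domain of definition is
`D = {(t, ω, x) | x ∈ E, φ t ω x ∈ E}`. -/
structure LocalRDS (Ω E : Type*) [MeasurableSpace Ω] [MetricSpace E] [MeasurableSpace E]
    (P : Measure Ω) extends ErgodicMDS Ω P where
  φ : ℝ≥0 → Ω → Option E → Option E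
  measurable_φ : Measurable (fun p : ℝ≥0 × Ω × Option E => φ p.1 p.2.1 p.2.2)
  /-- `φ⁻¹(E) ⊆ ℝ≥0 × Ω × E`. -/
  φ_none : ∀ t ω, φ t ω none = none
  isOpen_domain : ∀ ω, IsOpen {p : ℝ≥0 × E | φ p.1 ω (some p.2) ≠ none}
  domain_downward : ∀ (ω : Ω) (x : E) (s t : ℝ≥0), s ≤ t →
    φ t ω (some x) ≠ none → φ s ω (some x) ≠ none
  /-- `x ↦ φ t ω x` is continuous at `x₀` whenever `φ t ω x₀ = y ∈ E`. -/
  continuous_φ : ∀ (t : ℝ≥0) (ω : Ω) (x₀ y : E), φ t ω (some x₀) = some y →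
    Tendsto (fun x : E => φ t ω (some x)) (𝓝 x₀) (Filter.map some (𝓝 y))
  φ_zero : ∀ ω x, φ 0 ω x = x
  φ_add : ∀ (t s : ℝ≥0) (ω : Ω) (x : Option E), φ (t + s) ω x = φ t (θ s ω) (φ s ω x)

/-- A local white noise random dynamical system; `𝓕 s t` only matters for `s ≤ t`. -/
structure WhiteNoiseRDS (Ω E : Type*) [MeasurableSpace Ω] [MetricSpace E] [MeasurableSpace E]
    (P : Measure Ω) extends LocalRDS Ω E P where
  𝓕 : ℝ → ℝ → MeasurableSpace Ω
  𝓕_le : ∀ s t, s ≤ t → 𝓕 s t ≤ ‹MeasurableSpace Ω›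
  𝓕_mono : ∀ s t u v, s ≤ t → t ≤ u → u ≤ v → 𝓕 t u ≤ 𝓕 s v
  comap_𝓕 : ∀ r s t, s ≤ t → (𝓕 s t).comap (θ r) = 𝓕 (s + r) (t + r)
  indep_𝓕 : ∀ s t u v, s ≤ t → t ≤ u → u ≤ v → Indep (𝓕 s t) (𝓕 u v) P
  /-- `(ω, x) ↦ φ s ω x` is `𝓕 0 s ⊗ 𝓑(Ē)`-measurable; in particular each `φ s · x` is
  `𝓕 0 s`-measurable, and for a global system on a separable `E` the two are equivalent. -/
  adapted_φ : ∀ s : ℝ≥0,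
    @Measurable (Ω × Option E) (Option E) ((𝓕 0 s).prod inferInstance) inferInstance
      (fun p => φ s p.1 p.2)

/-- The distance on `Ē`, equal to `∞` as soon as one of the points is `∂`. -/
noncomputable def dist' {E : Type*} [MetricSpace E] : Option E → Option E → ℝ≥0∞
  | some x, some y => edist x y
  | _, _ => ⊤

/-- The distance of a point of `Ē` to a subset of `E`, equal to `∞` if the point is `∂`. -/
noncomputable def distSet {E : Type*} [MetricSpace E] : Option E → Set E → ℝ≥0∞
  | some x, A => Metric.infEDist x A
  | none, _ => ⊤

/-- Extension of a function on `E` to `Ē` by `0` at `∂`. -/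
def extendZero {E : Type*} (f : E → ℝ) : Option E → ℝ
  | some x => f x
  | none => 0

namespace WhiteNoiseRDS

variable {Ω E : Type*} [MeasurableSpace Ω] [MetricSpace E] [MeasurableSpace E]
  {P : Measure Ω} (Φ : WhiteNoiseRDS Ω E P)

/-- The past `𝓕_t`, generated by all `𝓕 s t`, `s ≤ t`. -/
abbrev past (t : ℝ) : MeasurableSpace Ω := ⨆ (s : ℝ) (_ : s ≤ t), Φ.𝓕 s t

/-- All trajectories `t ↦ φ t ω x` are right-continuous
(up to explosion; afterwards they are constantly `∂`). -/
def RightContinuous : Prop :=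
  ∀ (ω : Ω) (x y : E) (t : ℝ≥0), Φ.φ t ω (some x) = some y →
    Tendsto (fun s : ℝ≥0 => Φ.φ s ω (some x)) (𝓝[>] t) (Filter.map some (𝓝 y))

/-- Strong mixing: for each `x ∈ E` the law of `φ t · x` converges weakly to the probability
measure `ρ` on `E`. Testing with `f = 1` shows `P (φ t · x ∈ E) → 1`; as this probability is
nonincreasing in `t`, a strongly mixing system is weakly complete. -/
def StronglyMixing (ρ : Measure E) : Prop :=
  IsProbabilityMeasure ρ ∧ ∀ (f : E →ᵇ ℝ) (x : E),
    Tendsto (fun t : ℝ≥0 => ∫ ω, extendZero f (Φ.φ t ω (some x)) ∂P) atTop (𝓝 (∫ y, f y ∂ρ))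

/-- `μ` is (a version of) the statistical equilibrium associated with `ρ`: an `𝓕_0`-measurable
random probability measure such that for every sequence `t_k → ∞`, almost surely,
`φ_{t_k}(θ_{-t_k} ω) ρ → μ_ω` weakly. -/
def IsStatisticalEquilibrium (ρ : Measure E) (μ : Ω → Measure E) : Prop :=
  (∀ ω, IsProbabilityMeasure (μ ω)) ∧
  @Measurable Ω (Measure E) (Φ.past 0) inferInstance μ ∧
  ∀ t : ℕ → ℝ≥0, Tendsto t atTop atTop → ∀ᵐ ω ∂P, ∀ f : E →ᵇ ℝ,
    Tendsto (fun k => ∫ x, extendZero f (Φ.φ (t k) (Φ.θ (-(t k : ℝ)) ω) (some x)) ∂ρ) atTop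
      (𝓝 (∫ y, f y ∂(μ ω)))

/-- `φ` is weakly asymptotically stable on the non-empty open set `U`. -/
def WeaklyAsymptoticallyStable (U : Set E) : Prop :=
  IsOpen U ∧ U.Nonempty ∧
  ∃ t : ℕ → ℝ≥0, Monotone t ∧ Tendsto t atTop atTop ∧
  ∃ M : Set Ω, MeasurableSet M ∧ 0 < P M ∧ ∀ x ∈ U, ∀ y ∈ U, ∀ ε : ℝ≥0∞, 0 < ε →
    Tendsto (fun n => P {ω | ω ∈ M ∧ ε ≤ dist' (Φ.φ (t n) ω (some x)) (Φ.φ (t n) ω (some y))})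
      atTop (𝓝 0)

/-- Pointwise strong swift transitivity. The starting points are distinct: for `x₁ = x₂` the
target ball would be empty. -/
def PointwiseStronglySwiftTransitive : Prop :=
  ∃ t : ℝ≥0, 0 < t ∧ ∀ x₁ x₂ : E, x₁ ≠ x₂ → ∀ y : E,
    0 < P {ω | Φ.φ t ω '' {some x₁, some x₂} ⊆ some '' Metric.ball y (2 * dist x₁ x₂)}

/-- A random compact set: non-empty subsets of `E`, almost surely compact,
with measurable distance functions. -/
def IsRandomCompactSet (P : Measure Ω) (A : Ω → Set E) : Prop :=
  (∀ ω, (A ω).Nonempty) ∧ (∀ᵐ ω ∂P, IsCompact (A ω)) ∧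
    ∀ x : E, Measurable (fun ω => Metric.infDist x (A ω))

/-- `φ`-invariance of a random set: `φ_t(ω, A(ω)) = A(θ_t ω)` a.s. for each `t ≥ 0`. -/
def IsInvariant (A : Ω → Set E) : Prop :=
  ∀ t : ℝ≥0, ∀ᵐ ω ∂P, Φ.φ t ω '' (some '' A ω) = some '' A (Φ.θ t ω)

/-- A weak point attractor: an invariant random compact set with
`d(φ_t(θ_{-t} ω, x), A(ω)) → 0` in probability for each `x ∈ E`. -/
def IsWeakPointAttractor (A : Ω → Set E) : Prop :=
  IsRandomCompactSet P A ∧ Φ.IsInvariant A ∧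
  ∀ x : E, ∀ ε : ℝ≥0∞, 0 < ε →
    Tendsto (fun t : ℝ≥0 => P {ω | ε ≤ distSet (Φ.φ t (Φ.θ (-(t : ℝ)) ω) (some x)) (A ω)})
      atTop (𝓝 0)

/-- A minimal weak point attractor: contained a.s. in each weak point attractor. -/
def IsMinimalWeakPointAttractor (A : Ω → Set E) : Prop :=
  Φ.IsWeakPointAttractor A ∧ ∀ A' : Ω → Set E, Φ.IsWeakPointAttractor A' → ∀ᵐ ω ∂P, A ω ⊆ A' ω

end WhiteNoiseRDS

end WeakSync

/-!
Every trajectory of a strongly mixing system survives almost surely, so the flow can be regarded as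
`E`-valued (`flow`), up to null sets depending on the starting point. Let `π_t` be the law of the
two-point motion at time `t`, driven by one noise and started from `ρ ⊗ ρ` (`pairLaw`).

*Invariant laws of the two-point motion sit on the diagonal* (`ae_eq_of_pairLaw_eq`). The diagonal
is absorbing, so an invariant law `π` lets no mass flow into it. By weak asymptotic stability,
pairs in `U × U` come within distance `ε` with a probability bounded below uniformly in `ε`, and by
invariance the off-diagonal pairs at distance less than `ε` would carry a fixed mass; letting `ε`
tend to `0` shows that `π` charges no off-diagonal pair in `U × U`. Swift transitivity would carry
close off-diagonal pairs into `U × U`, so `π` charges none of these either. Since all pairs of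
trajectories come close at some time, nothing is left off the diagonal.

*The laws `π_t` converge to the diagonal* (`syncInMean`). Their marginals are `ρ`, hence they are
tight. The integral of `f ⊗ f` is nondecreasing in `t`, because points driven by the same noise are
positively correlated (`monotone_integral_tensor_self`); so the integrals of all `f ⊗ g` converge,
which makes every limit point of `π_t` an invariant law.

*The random point* (`exists_pullback_limit`). Comparing a pullback trajectory started from `x` at
time `-t` with one started from a `ρ`-distributed point at time `-s`, and letting `t` tend to
infinity, strong mixing gives the mean truncated distance under `π_s`. Hence the pullback
trajectories are Cauchy in probability, with a limit `a` that does not depend on `x`. It is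
measurable with respect to the past, has law `ρ` and is invariant under the flow; this yields the
attractor and its minimality.

*The statistical equilibrium.* By invariance, and by the independence of past and future,
`∫ f (φ_t (θ_{-t} ω) x) ρ(dx)` is the conditional expectation of `f ∘ a` given the noise on
`[-t, 0]` (`condExp_eq`), so Lévy's upward theorem shows that the images of `ρ` converge to the
Dirac mass at `a ω` almost surely along monotone sequences of times; any sequence tending to
infinity runs through the values of a monotone one.
-/

namespace WeakSync

/-! ### Freezing an independent random variable -/

theorem map_comp_prodMk_of_indepFun {Ω Ω' S R : Type*} [MeasurableSpace Ω] [MeasurableSpace Ω']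
    [MeasurableSpace S] [MeasurableSpace R] {P : Measure Ω} [IsProbabilityMeasure P]
    {W : Ω → Ω'} {Z : Ω → S} (hW : Measurable W) (hZ : Measurable Z) (hind : IndepFun W Z P)
    {G : Ω' × S → R} (hG : Measurable G) :
    P.map (fun ω => G (W ω, Z ω)) = (P.prod (P.map Z)).map (fun p => G (W p.1, p.2)) := by
  have hZp : IsProbabilityMeasure (P.map Z) := Measure.isProbabilityMeasure_map hZ.aemeasurable
  have h1 : P.map (fun ω => (W ω, Z ω)) = (P.map W).prod (P.map Z) :=
    (indepFun_iff_map_prod_eq_prod_map_map hW.aemeasurable hZ.aemeasurable).1 hind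
  have h2 : (P.map W).prod (P.map Z) = (P.prod (P.map Z)).map (Prod.map W id) := by
    have := Measure.map_prod_map P (P.map Z) hW measurable_id
    rwa [Measure.map_id] at this
  calc P.map (fun ω => G (W ω, Z ω)) = (P.map (fun ω => (W ω, Z ω))).map G :=
        (Measure.map_map hG (hW.prodMk hZ)).symm
    _ = _ := by
        rw [h1, h2, Measure.map_map hG (hW.prodMap measurable_id)]
        rfl

/-- **Freezing lemma.** If `Z` is `𝒢`-measurable and the random map `G` is measurable with respect
to a `σ`-algebra independent of `𝒢`, then the law of `G (ω, Z ω)` does not change when `Z` is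
replaced by an independent copy of itself. -/
theorem map_freeze {Ω S R : Type*} {𝒢 ℋ mΩ : MeasurableSpace Ω} [mS : MeasurableSpace S]
    [MeasurableSpace R] {P : Measure Ω} [IsProbabilityMeasure P] (h𝒢 : 𝒢 ≤ mΩ) (hℋ : ℋ ≤ mΩ)
    (hind : Indep 𝒢 ℋ P) {Z : Ω → S} (hZ : Measurable[𝒢] Z) {G : Ω × S → R}
    (hG : @Measurable _ _ (ℋ.prod mS) _ G) :
    P.map (fun ω => G (ω, Z ω)) = (P.prod (P.map Z)).map G := by
  refine @map_comp_prodMk_of_indepFun Ω Ω S R mΩ ℋ mS _ P _ id Z (measurable_id'' hℋ)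
    (hZ.mono h𝒢 le_rfl) ?_ G hG
  have h : Indep (ℋ.comap id) (mS.comap Z) P := by
    rw [MeasurableSpace.comap_id]
    exact indep_of_indep_of_le_right hind.symm hZ.comap_le
  exact (@IndepFun_iff_Indep Ω Ω S mΩ ℋ mS id Z P).2 h

/-- The freezing lemma with an additional parameter, integrated against `ν`. -/
theorem map_prod_freeze {Ω S S' R : Type*} {𝒢 ℋ mΩ : MeasurableSpace Ω} [mS : MeasurableSpace S]
    [mS' : MeasurableSpace S'] [MeasurableSpace R] {P : Measure Ω} [IsProbabilityMeasure P]
    (h𝒢 : 𝒢 ≤ mΩ) (hℋ : ℋ ≤ mΩ)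
    (hind : Indep 𝒢 ℋ P) (ν : Measure S') [IsProbabilityMeasure ν] {Z : Ω × S' → S}
    (hZ : @Measurable _ _ (𝒢.prod mS') _ Z) {G : Ω × S → R}
    (hG : @Measurable _ _ (ℋ.prod mS) _ G) :
    (P.prod ν).map (fun p => G (p.1, Z p)) = (P.prod ((P.prod ν).map Z)).map G := by
  have hZ' : Measurable Z := hZ.mono (sup_le_sup (MeasurableSpace.comap_mono h𝒢) le_rfl) le_rfl
  have hG' : Measurable G := hG.mono (sup_le_sup (MeasurableSpace.comap_mono hℋ) le_rfl) le_rfl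
  have hGZ : Measurable (fun p : Ω × S' => G (p.1, Z p)) :=
    hG'.comp (measurable_fst.prodMk hZ')
  ext A hA
  rw [Measure.map_apply hGZ hA, Measure.map_apply hG' hA,
    Measure.prod_apply_symm (hGZ hA), Measure.prod_apply_symm (hG' hA), lintegral_map _ hZ']
  · rw [lintegral_prod_symm']
    · refine lintegral_congr fun z => ?_
      have hz : Measurable[𝒢] (fun ω => Z (ω, z)) :=
        @Measurable.comp _ _ _ 𝒢 (𝒢.prod mS') _ _ _ hZ (@measurable_prodMk_right _ _ 𝒢 _ _)
      have := congrArg (fun m => m A) (map_freeze h𝒢 hℋ hind hz hG)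
      have hGz : Measurable fun ω => G (ω, Z (ω, z)) := hGZ.comp measurable_prodMk_right
      rw [Measure.map_apply hGz hA,
        Measure.map_apply hG' hA, Measure.prod_apply_symm (hG' hA),
        lintegral_map _ (hz.mono h𝒢 le_rfl)] at this
      · exact this
      · exact measurable_measure_prodMk_right (hG' hA)
    · exact (measurable_measure_prodMk_right (hG' hA)).comp hZ'
  · exact measurable_measure_prodMk_right (hG' hA)


/-! ### The flow with values in `E` -/

theorem measurable_getD {E : Type*} [MeasurableSpace E] (e : E) :
    Measurable (fun x : Option E => x.getD e) := fun _ hs => hs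

theorem measurable_some {E : Type*} [MeasurableSpace E] :
    Measurable (some : E → Option E) := fun _ hs => hs

theorem measurableSet_ne_none {E : Type*} [MeasurableSpace E] :
    MeasurableSet {o : Option E | o ≠ none} := by
  change MeasurableSet (some ⁻¹' {o : Option E | o ≠ none})
  convert MeasurableSet.univ
  ext; simp

namespace WhiteNoiseRDS

variable {Ω E : Type*} [mΩ : MeasurableSpace Ω] [MetricSpace E] [mE : MeasurableSpace E]
  {P : Measure Ω} (Φ : WhiteNoiseRDS Ω E P)

/-- No trajectory explodes almost surely. -/
def WeaklyComplete : Prop := ∀ (t : ℝ≥0) (x : E), ∀ᵐ ω ∂P, Φ.φ t ω (some x) ≠ none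

/-- The flow as an `E`-valued map, with the cemetery point replaced by the point `e` of `E`. For a
weakly complete system the choice of `e` only matters on a null set, for each starting point. -/
def flow (e : E) (t : ℝ≥0) (ω : Ω) (x : E) : E := (Φ.φ t ω (some x)).getD e

variable {Φ} {e : E}

theorem WeaklyComplete.some_flow (hwc : Φ.WeaklyComplete) (e : E) (t : ℝ≥0) (x : E) :
    ∀ᵐ ω ∂P, Φ.φ t ω (some x) = some (Φ.flow e t ω x) := by
  filter_upwards [hwc t x] with ω hω
  obtain ⟨y, hy⟩ := Option.ne_none_iff_exists'.1 hω
  simp [flow, hy]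

theorem flow_eq_of_eq_some {t : ℝ≥0} {ω : Ω} {x y : E} (h : Φ.φ t ω (some x) = some y) :
    Φ.flow e t ω x = y := by simp [flow, h]

theorem continuousAt_flow_of_ne_none {t : ℝ≥0} {ω : Ω} {x : E} (h : Φ.φ t ω (some x) ≠ none) :
    ContinuousAt (Φ.flow e t ω) x := by
  obtain ⟨y, hy⟩ := Option.ne_none_iff_exists'.1 h
  have h1 := Φ.continuous_φ t ω x y hy
  have h2 : Tendsto (fun o : Option E => o.getD e) (Filter.map some (𝓝 y)) (𝓝 y) := by
    rw [tendsto_map'_iff]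
    exact tendsto_id
  rw [ContinuousAt, flow_eq_of_eq_some hy]
  exact h2.comp h1

theorem measurable_flow_𝓕 (t : ℝ≥0) :
    @Measurable _ _ ((Φ.𝓕 0 t).prod mE) _ (fun p : Ω × E => Φ.flow e t p.1 p.2) := by
  have h := Φ.adapted_φ t
  have h1 : @Measurable _ _ ((Φ.𝓕 0 t).prod mE) ((Φ.𝓕 0 t).prod inferInstance)
      (fun p : Ω × E => (p.1, some p.2)) :=
    @Measurable.prodMk _ ((Φ.𝓕 0 t).prod mE) _ _ (Φ.𝓕 0 t) _ _ _
      (@measurable_fst _ _ (Φ.𝓕 0 t) _)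
      (measurable_some.comp (@measurable_snd _ _ (Φ.𝓕 0 t) _))
  exact (measurable_getD e).comp (h.comp h1)

theorem measurable_flow (t : ℝ≥0) : Measurable (fun p : Ω × E => Φ.flow e t p.1 p.2) :=
  (measurable_flow_𝓕 t).mono
    (sup_le_sup (MeasurableSpace.comap_mono (Φ.𝓕_le 0 t t.2)) le_rfl) le_rfl

theorem measurable_flow_left (t : ℝ≥0) (x : E) : Measurable (fun ω => Φ.flow e t ω x) :=
  (measurable_flow t).comp measurable_prodMk_right

theorem measurable_flow_left_𝓕 (t : ℝ≥0) (x : E) :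
    Measurable[Φ.𝓕 0 t] (fun ω => Φ.flow e t ω x) :=
  @Measurable.comp _ _ _ (Φ.𝓕 0 t) ((Φ.𝓕 0 t).prod mE) _ _ _ (measurable_flow_𝓕 t)
    (@measurable_prodMk_right _ _ (Φ.𝓕 0 t) _ _)

theorem measurable_θ' (t : ℝ) : Measurable (Φ.θ t) :=
  Φ.measurable_θ.comp measurable_prodMk_left

theorem measurePreserving_θ (t : ℝ) : MeasurePreserving (Φ.θ t) P P :=
  ⟨measurable_θ' t, Φ.map_θ t⟩

theorem θ_θ_neg (t : ℝ) (ω : Ω) : Φ.θ t (Φ.θ (-t) ω) = ω := by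
  rw [← Φ.θ_add, add_neg_cancel, Φ.θ_zero]

theorem θ_neg_θ (t : ℝ) (ω : Ω) : Φ.θ (-t) (Φ.θ t ω) = ω := by
  rw [← Φ.θ_add, neg_add_cancel, Φ.θ_zero]

theorem measurable_θ_𝓕 (r s t : ℝ) (hst : s ≤ t) :
    @Measurable _ _ (Φ.𝓕 (s + r) (t + r)) (Φ.𝓕 s t) (Φ.θ r) := by
  rw [measurable_iff_comap_le, Φ.comap_𝓕 r s t hst]

/-- `(ω, x) ↦ φ_t (θ_r ω, x)` only depends on the noise between the times `r` and `t + r`. -/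
theorem measurable_flow_θ_𝓕 (t : ℝ≥0) (r : ℝ) :
    @Measurable _ _ ((Φ.𝓕 r (t + r)).prod mE) _
      (fun p : Ω × E => Φ.flow e t (Φ.θ r p.1) p.2) := by
  have h := measurable_θ_𝓕 (Φ := Φ) r 0 t t.2
  rw [zero_add] at h
  have h1 : @Measurable _ _ ((Φ.𝓕 r (t + r)).prod mE) ((Φ.𝓕 0 t).prod mE)
      (fun p : Ω × E => (Φ.θ r p.1, p.2)) :=
    @Measurable.prodMk _ ((Φ.𝓕 r (t + r)).prod mE) _ _ (Φ.𝓕 0 t) _ _ _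
      (h.comp (@measurable_fst _ _ (Φ.𝓕 r (t + r)) _)) (@measurable_snd _ _ (Φ.𝓕 r (t + r)) _)
  exact (measurable_flow_𝓕 t).comp h1

theorem indep_𝓕_zero (r t : ℝ≥0) : Indep (Φ.𝓕 0 r) (Φ.𝓕 r (t + r)) P :=
  Φ.indep_𝓕 0 r r (t + r) r.2 le_rfl (by simp)

theorem flow_add (hwc : Φ.WeaklyComplete) (t s : ℝ≥0) (x : E) :
    ∀ᵐ ω ∂P, Φ.flow e (t + s) ω x = Φ.flow e t (Φ.θ s ω) (Φ.flow e s ω x) := by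
  filter_upwards [hwc.some_flow e s x] with ω h1
  simp only [flow, Φ.φ_add t s ω (some x)] at h1 ⊢
  rw [← h1]

theorem continuousAt_flow (hwc : Φ.WeaklyComplete) (t : ℝ≥0) (x : E) :
    ∀ᵐ ω ∂P, ContinuousAt (Φ.flow e t ω) x := by
  filter_upwards [hwc t x] with ω h using continuousAt_flow_of_ne_none h

/-! ### Weak completeness and the invariant measure -/

variable {ρ : Measure E}

theorem StronglyMixing.weaklyComplete [IsProbabilityMeasure P] (hmix : Φ.StronglyMixing ρ) :
    Φ.WeaklyComplete := by
  intro t x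
  have := hmix.1
  have h := hmix.2 1 x
  have hms (s : ℝ≥0) : MeasurableSet {ω | Φ.φ s ω (some x) ≠ none} := by
    have hm : Measurable (fun ω => Φ.φ s ω (some x)) :=
      Φ.measurable_φ.comp (measurable_prodMk_left.comp measurable_prodMk_right)
    exact hm measurableSet_ne_none
  have hint (s : ℝ≥0) : ∫ ω, extendZero (1 : E →ᵇ ℝ) (Φ.φ s ω (some x)) ∂P
      = P.real {ω | Φ.φ s ω (some x) ≠ none} := by
    rw [← integral_indicator_one (hms s)]
    congr with ω
    rcases hω : Φ.φ s ω (some x) with _ | y <;> simp [extendZero, hω]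
  replace h := h.congr hint
  simp only [BoundedContinuousFunction.coe_one, Pi.one_apply, integral_const,
    probReal_univ, smul_eq_mul, mul_one] at h
  -- the probability of survival up to time `s` is nonincreasing in `s` and tends to `1`
  have h1 : 1 ≤ P.real {ω | Φ.φ t ω (some x) ≠ none} := by
    refine le_of_tendsto h ?_
    filter_upwards [eventually_ge_atTop t] with s hs
    exact measureReal_mono fun ω hω => Φ.domain_downward ω x t s hs hω
  have h2 : P {ω | Φ.φ t ω (some x) ≠ none} = 1 := by
    have : P.real {ω | Φ.φ t ω (some x) ≠ none} = 1 := le_antisymm measureReal_le_one h1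
    rwa [measureReal_def, ENNReal.toReal_eq_one_iff] at this
  rw [ae_iff, ← prob_compl_eq_one_iff (by exact (hms t).compl)]
  convert h2 using 2
  ext; simp

theorem StronglyMixing.tendsto_integral_flow [IsProbabilityMeasure P] (hmix : Φ.StronglyMixing ρ)
    (f : E →ᵇ ℝ) (x : E) :
    Tendsto (fun t : ℝ≥0 => ∫ ω, f (Φ.flow e t ω x) ∂P) atTop (𝓝 (∫ y, f y ∂ρ)) := by
  refine (hmix.2 f x).congr fun t => integral_congr_ae ?_
  filter_upwards [hmix.weaklyComplete.some_flow e t x] with ω h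
  rw [h, extendZero]

end WhiteNoiseRDS

namespace WhiteNoiseRDS

/-! ### The one-point and two-point Markov semigroups -/

variable {Ω E : Type*} [mΩ : MeasurableSpace Ω] [MetricSpace E] [mE : MeasurableSpace E]
  {P : Measure Ω} (Φ : WhiteNoiseRDS Ω E P)

/-- The two-point motion. -/
def pairFlow (e : E) (t : ℝ≥0) (ω : Ω) (z : E × E) : E × E := (Φ.flow e t ω z.1, Φ.flow e t ω z.2)

/-- The law at time `t` of the two-point motion with initial law `π`. -/
noncomputable def pairLaw (e : E) (t : ℝ≥0) (π : Measure (E × E)) : Measure (E × E) :=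
  (P.prod π).map (fun p => Φ.pairFlow e t p.1 p.2)

variable {Φ} {e : E}

theorem measurable_pair_of_measurable {Ω' S R : Type*} [MeasurableSpace Ω'] [MeasurableSpace S]
    [MeasurableSpace R] {g : Ω' × S → R} (hg : Measurable g) :
    Measurable (fun p : Ω' × (S × S) => (g (p.1, p.2.1), g (p.1, p.2.2))) := by
  fun_prop

theorem measurable_pairFlow_𝓕 (t : ℝ≥0) :
    @Measurable _ _ ((Φ.𝓕 0 t).prod inferInstance) _
      (fun p : Ω × (E × E) => Φ.pairFlow e t p.1 p.2) :=
  @measurable_pair_of_measurable _ _ _ (Φ.𝓕 0 t) _ _ _ (measurable_flow_𝓕 t)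

theorem measurable_pairFlow_θ_𝓕 (t : ℝ≥0) (r : ℝ) :
    @Measurable _ _ ((Φ.𝓕 r (t + r)).prod inferInstance) _
      (fun p : Ω × (E × E) => Φ.pairFlow e t (Φ.θ r p.1) p.2) :=
  @measurable_pair_of_measurable _ _ _ (Φ.𝓕 r (t + r)) _ _ _ (measurable_flow_θ_𝓕 t r)

theorem measurable_pairFlow (t : ℝ≥0) :
    Measurable (fun p : Ω × (E × E) => Φ.pairFlow e t p.1 p.2) :=
  (measurable_pairFlow_𝓕 t).mono
    (sup_le_sup (MeasurableSpace.comap_mono (Φ.𝓕_le 0 t t.2)) le_rfl) le_rfl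

theorem measurable_pairFlow_left (t : ℝ≥0) (z : E × E) :
    Measurable (fun ω => Φ.pairFlow e t ω z) :=
  (measurable_pairFlow t).comp measurable_prodMk_right

section Law

variable [IsProbabilityMeasure P]

instance isProbabilityMeasure_pairLaw (t : ℝ≥0) (π : Measure (E × E)) [IsProbabilityMeasure π] :
    IsProbabilityMeasure (Φ.pairLaw e t π) :=
  Measure.isProbabilityMeasure_map (measurable_pairFlow t).aemeasurable

theorem ae_prod_of_forall_ae {S : Type*} [MeasurableSpace S] {ν : Measure S} [SFinite ν]
    {p : Ω × S → Prop} (hp : MeasurableSet {x | p x}) (h : ∀ z, ∀ᵐ ω ∂P, p (ω, z)) :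
    ∀ᵐ x ∂(P.prod ν), p x := by
  rw [Measure.ae_prod_iff_ae_ae hp]
  exact (Measure.ae_ae_comm hp).2 (.of_forall h)

theorem map_prod_θ {S R : Type*} [MeasurableSpace S] [MeasurableSpace R] (r : ℝ) (ν : Measure S)
    [SFinite ν] {H : Ω × S → R} (hH : Measurable H) :
    (P.prod ν).map (fun p => H (Φ.θ r p.1, p.2)) = (P.prod ν).map H := by
  have h := Measure.map_prod_map P ν (measurable_θ' (Φ := Φ) r) measurable_id
  rw [Φ.map_θ, Measure.map_id] at h
  conv_rhs => rw [h, Measure.map_map hH ((measurable_θ' r).prodMap measurable_id)]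
  rfl

theorem map_pairFlow_θ {S : Type*} [mS : MeasurableSpace S] (ν : Measure S)
    [IsProbabilityMeasure ν] (s r : ℝ≥0) {Z : Ω × S → E × E}
    (hZ : @Measurable _ _ ((Φ.𝓕 0 r).prod mS) _ Z) :
    (P.prod ν).map (fun p => Φ.pairFlow e s (Φ.θ r p.1) (Z p))
      = Φ.pairLaw e s ((P.prod ν).map Z) := by
  rw [map_prod_freeze (Φ.𝓕_le 0 r r.2) (Φ.𝓕_le r (s + r) (by simp)) (indep_𝓕_zero r s) ν hZ
    (G := fun p => Φ.pairFlow e s (Φ.θ r p.1) p.2) (measurable_pairFlow_θ_𝓕 s r), pairLaw,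
    map_prod_θ (H := fun p => Φ.pairFlow e s p.1 p.2) _ _ (measurable_pairFlow s)]

theorem map_flow_add (hwc : Φ.WeaklyComplete) [SecondCountableTopology E] [BorelSpace E]
    (t s : ℝ≥0) (x : E) :
    P.map (fun ω => Φ.flow e (t + s) ω x)
      = (P.prod (P.map fun ω => Φ.flow e s ω x)).map (fun p => Φ.flow e t p.1 p.2) := by
  rw [Measure.map_congr (flow_add hwc t s x), map_freeze (Φ.𝓕_le 0 s s.2)
    (Φ.𝓕_le s (t + s) (by simp)) (indep_𝓕_zero s t) (measurable_flow_left_𝓕 s x)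
    (G := fun p => Φ.flow e t (Φ.θ s p.1) p.2) (measurable_flow_θ_𝓕 t s),
    map_prod_θ (H := fun p => Φ.flow e t p.1 p.2) _ _ (measurable_flow t)]

theorem pairLaw_pairLaw [SecondCountableTopology E] [BorelSpace E] (hwc : Φ.WeaklyComplete)
    (t s : ℝ≥0) (π : Measure (E × E)) [IsProbabilityMeasure π] :
    Φ.pairLaw e t (Φ.pairLaw e s π) = Φ.pairLaw e (t + s) π := by
  have hm : Measurable (fun p : Ω × (E × E) =>
      Φ.pairFlow e t (Φ.θ s p.1) (Φ.pairFlow e s p.1 p.2)) :=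
    (measurable_pairFlow t).comp (((measurable_θ' s).comp measurable_fst).prodMk
      (measurable_pairFlow s))
  calc Φ.pairLaw e t (Φ.pairLaw e s π)
      = (P.prod π).map (fun p => Φ.pairFlow e t (Φ.θ s p.1) (Φ.pairFlow e s p.1 p.2)) :=
        (map_pairFlow_θ π t s (measurable_pairFlow_𝓕 s)).symm
    _ = _ := by
        refine Measure.map_congr (ae_prod_of_forall_ae
          (measurableSet_eq_fun hm (measurable_pairFlow (t + s))) fun z => ?_)
        filter_upwards [flow_add (e := e) hwc t s z.1, flow_add (e := e) hwc t s z.2] with ω h1 h2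
        simp only [pairFlow, h1, h2]

theorem fst_pairLaw (t : ℝ≥0) (π : Measure (E × E)) [IsProbabilityMeasure π] :
    (Φ.pairLaw e t π).fst = (P.prod π.fst).map (fun p => Φ.flow e t p.1 p.2) := by
  have h := Measure.map_prod_map P π measurable_id measurable_fst
  rw [Measure.map_id] at h
  rw [Measure.fst, pairLaw, Measure.map_map measurable_fst (measurable_pairFlow t), Measure.fst, h,
    Measure.map_map (measurable_flow t) (measurable_id.prodMap measurable_fst)]
  rfl

theorem snd_pairLaw (t : ℝ≥0) (π : Measure (E × E)) [IsProbabilityMeasure π] :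
    (Φ.pairLaw e t π).snd = (P.prod π.snd).map (fun p => Φ.flow e t p.1 p.2) := by
  have h := Measure.map_prod_map P π measurable_id measurable_snd
  rw [Measure.map_id] at h
  rw [Measure.snd, pairLaw, Measure.map_map measurable_snd (measurable_pairFlow t), Measure.snd, h,
    Measure.map_map (measurable_flow t) (measurable_id.prodMap measurable_snd)]
  rfl

end Law

section Feller

variable [IsProbabilityMeasure P] [SecondCountableTopology E] [BorelSpace E]

/-- The one-point semigroup acting on bounded continuous functions. -/
noncomputable def markovOp (hwc : Φ.WeaklyComplete) (e : E) (t : ℝ≥0) (f : E →ᵇ ℝ) : E →ᵇ ℝ :=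
  BoundedContinuousFunction.ofNormedAddCommGroup (fun x => ∫ ω, f (Φ.flow e t ω x) ∂P)
    (continuous_iff_continuousAt.2 fun x => continuousAt_of_dominated (bound := fun _ => ‖f‖)
      (.of_forall fun y =>
        (f.continuous.measurable.comp (measurable_flow_left t y)).aestronglyMeasurable)
      (.of_forall fun y => .of_forall fun ω => f.norm_coe_le_norm _) (integrable_const _) (by
        filter_upwards [continuousAt_flow hwc t x] with ω hω
        exact f.continuous.continuousAt.comp hω)) ‖f‖
    (fun x => by
      simpa using norm_integral_le_of_norm_le_const (μ := P) (C := ‖f‖)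
        (f := fun ω => f (Φ.flow e t ω x)) (.of_forall fun ω => f.norm_coe_le_norm _))

/-- The two-point semigroup acting on bounded continuous functions. -/
noncomputable def pairOp (hwc : Φ.WeaklyComplete) (e : E) (t : ℝ≥0) (f : E × E →ᵇ ℝ) :
    E × E →ᵇ ℝ :=
  BoundedContinuousFunction.ofNormedAddCommGroup (fun z => ∫ ω, f (Φ.pairFlow e t ω z) ∂P)
    (continuous_iff_continuousAt.2 fun z => continuousAt_of_dominated (bound := fun _ => ‖f‖)
      (.of_forall fun y =>
        (f.continuous.measurable.comp (measurable_pairFlow_left t y)).aestronglyMeasurable)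
      (.of_forall fun y => .of_forall fun ω => f.norm_coe_le_norm _) (integrable_const _) (by
        filter_upwards [continuousAt_flow hwc t z.1, continuousAt_flow hwc t z.2] with ω h1 h2
        exact f.continuous.continuousAt.comp
          ((h1.comp continuousAt_fst).prodMk (h2.comp continuousAt_snd)))) ‖f‖
    (fun z => by
      simpa using norm_integral_le_of_norm_le_const (μ := P) (C := ‖f‖)
        (f := fun ω => f (Φ.pairFlow e t ω z)) (.of_forall fun ω => f.norm_coe_le_norm _))

theorem integral_map_flow (hwc : Φ.WeaklyComplete) (t : ℝ≥0) (ν : Measure E)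
    [IsProbabilityMeasure ν] (f : E →ᵇ ℝ) :
    ∫ y, f y ∂((P.prod ν).map (fun p => Φ.flow e t p.1 p.2)) = ∫ x, markovOp hwc e t f x ∂ν := by
  rw [integral_map (measurable_flow t).aemeasurable
    f.continuous.measurable.aestronglyMeasurable, integral_prod_symm]
  · rfl
  · exact Integrable.of_bound
      (f.continuous.measurable.comp (measurable_flow t)).aestronglyMeasurable ‖f‖
      (.of_forall fun _ => f.norm_coe_le_norm _)

theorem integral_pairLaw (hwc : Φ.WeaklyComplete) (t : ℝ≥0) (π : Measure (E × E))
    [IsProbabilityMeasure π] (f : E × E →ᵇ ℝ) :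
    ∫ z, f z ∂(Φ.pairLaw e t π) = ∫ z, pairOp hwc e t f z ∂π := by
  rw [pairLaw, integral_map (measurable_pairFlow t).aemeasurable
    f.continuous.measurable.aestronglyMeasurable, integral_prod_symm]
  · rfl
  · exact Integrable.of_bound
      (f.continuous.measurable.comp (measurable_pairFlow t)).aestronglyMeasurable ‖f‖
      (.of_forall fun _ => f.norm_coe_le_norm _)

theorem tendsto_add_const_atTop (t : ℝ≥0) : Tendsto (fun s : ℝ≥0 => s + t) atTop atTop :=
  tendsto_atTop_mono (fun _ => le_self_add) tendsto_id

variable {ρ : Measure E}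

/-- The mixing limit is invariant under the one-point semigroup. -/
theorem StronglyMixing.map_flow (hmix : Φ.StronglyMixing ρ) (t : ℝ≥0) :
    (P.prod ρ).map (fun p => Φ.flow e t p.1 p.2) = ρ := by
  have := hmix.1
  have hwc := hmix.weaklyComplete
  have : IsProbabilityMeasure ((P.prod ρ).map (fun p => Φ.flow e t p.1 p.2)) :=
    Measure.isProbabilityMeasure_map (measurable_flow t).aemeasurable
  refine ext_of_forall_integral_eq_of_IsFiniteMeasure fun f => ?_
  rw [integral_map_flow hwc]
  have h1 := hmix.tendsto_integral_flow (e := e) (markovOp hwc e t f) e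
  have h2 := (hmix.tendsto_integral_flow (e := e) f e).comp
    (tendsto_add_const_atTop t)
  refine tendsto_nhds_unique h1 (h2.congr fun s => ?_)
  have hp : IsProbabilityMeasure (P.map fun ω => Φ.flow e s ω e) :=
    Measure.isProbabilityMeasure_map (measurable_flow_left s e).aemeasurable
  have h3 := congrArg (fun m => ∫ y, f y ∂m) (map_flow_add (e := e) hwc t s e)
  simp only [integral_map_flow hwc] at h3
  rw [integral_map (measurable_flow_left _ _).aemeasurable
      f.continuous.measurable.aestronglyMeasurable,
    integral_map (measurable_flow_left _ _).aemeasurable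
      (BoundedContinuousFunction.continuous _).measurable.aestronglyMeasurable] at h3
  rw [Function.comp_apply, add_comm s t]
  exact h3

end Feller

end WhiteNoiseRDS

/-! ### Limits of the two-point motion are invariant -/

/-- The function `(x, y) ↦ f x * g y`. -/
def tensor {E : Type*} [TopologicalSpace E] (f g : E →ᵇ ℝ) : E × E →ᵇ ℝ :=
  f.compContinuous ⟨Prod.fst, continuous_fst⟩ * g.compContinuous ⟨Prod.snd, continuous_snd⟩

theorem tensor_apply {E : Type*} [TopologicalSpace E] (f g : E →ᵇ ℝ) (z : E × E) :
    tensor f g z = f z.1 * g z.2 := rfl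

namespace WhiteNoiseRDS

variable {Ω E : Type*} [mΩ : MeasurableSpace Ω] [MetricSpace E] [mE : MeasurableSpace E]
  {P : Measure Ω} {Φ : WhiteNoiseRDS Ω E P} {e : E}
  [IsProbabilityMeasure P] [SecondCountableTopology E] [BorelSpace E] {ρ : Measure E}

omit [SecondCountableTopology E] [BorelSpace E] in
theorem integral_mul_pairLaw (t : ℝ≥0) (π : Measure (E × E)) [IsProbabilityMeasure π]
    {h k : E → ℝ} (hh : Measurable h) (hk : Measurable k) {C : ℝ} (hhC : ∀ x, |h x| ≤ C)
    (hkC : ∀ x, |k x| ≤ C) :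
    ∫ z, h z.1 * k z.2 ∂(Φ.pairLaw e t π)
      = ∫ ω, ∫ z, h (Φ.flow e t ω z.1) * k (Φ.flow e t ω z.2) ∂π ∂P := by
  have hm : Measurable (fun z : E × E => h z.1 * k z.2) := by fun_prop
  rw [pairLaw, integral_map (measurable_pairFlow t).aemeasurable hm.aestronglyMeasurable,
    integral_prod]
  · rfl
  · refine Integrable.of_bound (hm.comp (measurable_pairFlow t)).aestronglyMeasurable (C * C)
      (.of_forall fun p => ?_)
    rw [Real.norm_eq_abs, abs_mul]
    exact mul_le_mul (hhC _) (hkC _) (abs_nonneg _) ((abs_nonneg _).trans (hhC e))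

omit [SecondCountableTopology E] [BorelSpace E] in
theorem integral_mul_pairLaw_prod [IsProbabilityMeasure ρ] (t : ℝ≥0)
    {h k : E → ℝ} (hh : Measurable h) (hk : Measurable k) {C : ℝ} (hhC : ∀ x, |h x| ≤ C)
    (hkC : ∀ x, |k x| ≤ C) :
    ∫ z, h z.1 * k z.2 ∂(Φ.pairLaw e t (ρ.prod ρ))
      = ∫ ω, (∫ x, h (Φ.flow e t ω x) ∂ρ) * (∫ x, k (Φ.flow e t ω x) ∂ρ) ∂P := by
  rw [integral_mul_pairLaw t _ hh hk hhC hkC]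
  exact integral_congr_ae (.of_forall fun ω =>
    integral_prod_mul (fun x => h (Φ.flow e t ω x)) (fun x => k (Φ.flow e t ω x)))

/-- Two points driven by the same noise are positively correlated. -/
theorem sq_integral_le_integral_pairLaw (hmix : Φ.StronglyMixing ρ) (t : ℝ≥0) {h : E → ℝ}
    (hh : Measurable h) {C : ℝ} (hhC : ∀ x, |h x| ≤ C) :
    (∫ x, h x ∂ρ) * (∫ x, h x ∂ρ) ≤ ∫ z, h z.1 * h z.2 ∂(Φ.pairLaw e t (ρ.prod ρ)) := by
  have := hmix.1
  rw [integral_mul_pairLaw_prod t hh hh hhC hhC]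
  set c := ∫ x, h x ∂ρ with hc
  have hm : Measurable (fun p : Ω × E => h (Φ.flow e t p.1 p.2)) := hh.comp (measurable_flow t)
  have hint : Integrable (fun p : Ω × E => h (Φ.flow e t p.1 p.2)) (P.prod ρ) :=
    Integrable.of_bound hm.aestronglyMeasurable C (.of_forall fun _ => hhC _)
  have hN : ∫ ω, ∫ x, h (Φ.flow e t ω x) ∂ρ ∂P = c := by
    rw [hc, ← hmix.map_flow (e := e) t, integral_map (measurable_flow t).aemeasurable
      hh.aestronglyMeasurable, integral_prod _ hint, hmix.map_flow]
  have hNm : Measurable (fun ω => ∫ x, h (Φ.flow e t ω x) ∂ρ) :=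
    hm.stronglyMeasurable.integral_prod_right.measurable
  have hNC (ω : Ω) : |∫ x, h (Φ.flow e t ω x) ∂ρ| ≤ C := by
    simpa using norm_integral_le_of_norm_le_const (μ := ρ) (C := C)
        (f := fun x => h (Φ.flow e t ω x)) (.of_forall fun x => hhC _)
  set N := fun ω => ∫ x, h (Φ.flow e t ω x) ∂ρ with hNdef
  have hNi : Integrable N P := hint.integral_prod_left
  have hNN : Integrable (fun ω => N ω * N ω) P :=
    hNi.mul_bdd hNm.aestronglyMeasurable (.of_forall hNC)
  -- Jensen's inequality for the square, by expanding `(N - c) ^ 2`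
  calc c * c = ∫ ω, (2 * c * N ω - c * c) ∂P := by
        rw [integral_sub (hNi.const_mul _) (integrable_const _), integral_const_mul, hN]
        simp; ring
    _ ≤ ∫ ω, N ω * N ω ∂P :=
        integral_mono ((hNi.const_mul _).sub (integrable_const _)) hNN
          fun ω => by nlinarith [sq_nonneg (N ω - c)]

/-- By the semigroup property, `π_{t + s}` is `π_s` evolved for the time `t`; given the noise that
drives this evolution, `π_s` is compared with `ρ ⊗ ρ` by their positive correlation. -/
theorem monotone_integral_tensor_self (hmix : Φ.StronglyMixing ρ) (f : E →ᵇ ℝ) :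
    Monotone fun t : ℝ≥0 => ∫ z, tensor f f z ∂(Φ.pairLaw e t (ρ.prod ρ)) := by
  have := hmix.1
  intro t u htu
  obtain ⟨s, rfl⟩ := exists_add_of_le htu
  have hfm := f.continuous.measurable
  have hfC : ∀ x, |f x| ≤ ‖f‖ := f.norm_coe_le_norm
  simp only [tensor_apply]
  rw [← pairLaw_pairLaw hmix.weaklyComplete, integral_mul_pairLaw_prod t hfm hfm hfC hfC,
    integral_mul_pairLaw t _ hfm hfm hfC hfC]
  have hm : Measurable (fun p : Ω × E => f (Φ.flow e t p.1 p.2)) := hfm.comp (measurable_flow t)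
  have hNm : Measurable (fun ω => ∫ x, f (Φ.flow e t ω x) ∂ρ) :=
    hm.stronglyMeasurable.integral_prod_right.measurable
  have hNC (ω : Ω) : |∫ x, f (Φ.flow e t ω x) ∂ρ| ≤ ‖f‖ := by
    simpa using norm_integral_le_of_norm_le_const (μ := ρ) (C := ‖f‖)
        (f := fun x => f (Φ.flow e t ω x)) (.of_forall fun x => hfC _)
  refine integral_mono ?_ ?_ fun ω => sq_integral_le_integral_pairLaw hmix s
    (h := fun x => f (Φ.flow e t ω x)) (hm.comp measurable_prodMk_left) (fun x => hfC _)
  · exact Integrable.of_bound (hNm.mul hNm).aestronglyMeasurable (‖f‖ * ‖f‖)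
      (.of_forall fun ω => by
        rw [Real.norm_eq_abs, abs_mul]
        exact mul_le_mul (hNC _) (hNC _) (abs_nonneg _) (norm_nonneg _))
  · refine Integrable.integral_prod_left
      (f := fun p : Ω × (E × E) => f (Φ.flow e t p.1 p.2.1) * f (Φ.flow e t p.1 p.2.2)) ?_
    refine Integrable.of_bound ((hfm.comp (measurable_fst.comp (measurable_pairFlow t))).mul
      (hfm.comp (measurable_snd.comp (measurable_pairFlow t)))).aestronglyMeasurable (‖f‖ * ‖f‖)
      (.of_forall fun p => ?_)
    rw [Real.norm_eq_abs, abs_mul]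
    exact mul_le_mul (hfC _) (hfC _) (abs_nonneg _) (norm_nonneg _)

theorem abs_integral_le_norm {X : Type*} [TopologicalSpace X] [MeasurableSpace X]
    (π : Measure X) [IsProbabilityMeasure π] (f : X →ᵇ ℝ) : |∫ z, f z ∂π| ≤ ‖f‖ := by
  simpa using norm_integral_le_of_norm_le_const (μ := π) (C := ‖f‖) (f := f)
    (.of_forall fun z => f.norm_coe_le_norm z)

theorem exists_tendsto_integral_tensor_self (hmix : Φ.StronglyMixing ρ) (f : E →ᵇ ℝ) :
    ∃ l, Tendsto (fun t : ℝ≥0 => ∫ z, tensor f f z ∂(Φ.pairLaw e t (ρ.prod ρ))) atTop (𝓝 l) := by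
  have := hmix.1
  refine ⟨_, tendsto_atTop_ciSup (monotone_integral_tensor_self hmix f) ⟨‖tensor f f‖, ?_⟩⟩
  rintro _ ⟨t, rfl⟩
  exact (abs_le.1 (abs_integral_le_norm _ _)).2

/-- By polarization, the correlations of the two-point motion started from `ρ ⊗ ρ` converge. -/
theorem exists_tendsto_integral_tensor (hmix : Φ.StronglyMixing ρ) (f g : E →ᵇ ℝ) :
    ∃ l, Tendsto (fun t : ℝ≥0 => ∫ z, tensor f g z ∂(Φ.pairLaw e t (ρ.prod ρ))) atTop (𝓝 l) := by
  have := hmix.1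
  obtain ⟨a, ha⟩ := exists_tendsto_integral_tensor_self (e := e) hmix f
  obtain ⟨b, hb⟩ := exists_tendsto_integral_tensor_self (e := e) hmix g
  obtain ⟨c, hc⟩ := exists_tendsto_integral_tensor_self (e := e) hmix (f + g)
  refine ⟨(c - a - b) / 2, (((hc.sub ha).sub hb).div_const 2).congr fun t => ?_⟩
  have hi (F : E × E →ᵇ ℝ) : Integrable F (Φ.pairLaw e t (ρ.prod ρ)) := F.integrable _
  have hfm := f.continuous.measurable
  have hgm := g.continuous.measurable
  have hfC : ∀ x, |f x| ≤ max ‖f‖ ‖g‖ := fun x => (f.norm_coe_le_norm x).trans (le_max_left _ _)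
  have hgC : ∀ x, |g x| ≤ max ‖f‖ ‖g‖ := fun x => (g.norm_coe_le_norm x).trans (le_max_right _ _)
  have hsymm : ∫ z, tensor g f z ∂(Φ.pairLaw e t (ρ.prod ρ))
      = ∫ z, tensor f g z ∂(Φ.pairLaw e t (ρ.prod ρ)) := by
    simp only [tensor_apply]
    rw [integral_mul_pairLaw_prod t hfm hgm hfC hgC, integral_mul_pairLaw_prod t hgm hfm hgC hfC]
    simp only [mul_comm]
  have hexp : ∫ z, tensor (f + g) (f + g) z ∂(Φ.pairLaw e t (ρ.prod ρ))
      = ∫ z, tensor f f z ∂(Φ.pairLaw e t (ρ.prod ρ))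
        + ∫ z, tensor f g z ∂(Φ.pairLaw e t (ρ.prod ρ))
        + (∫ z, tensor g f z ∂(Φ.pairLaw e t (ρ.prod ρ))
        + ∫ z, tensor g g z ∂(Φ.pairLaw e t (ρ.prod ρ))) := by
    refine Eq.trans ?_ ((integral_add (hi (tensor f f + tensor f g))
      (hi (tensor g f + tensor g g))).trans (congrArg₂ _ (integral_add (hi _) (hi _))
      (integral_add (hi _) (hi _))))
    refine integral_congr_ae (.of_forall fun z => ?_)
    simp only [tensor_apply, BoundedContinuousFunction.coe_add, Pi.add_apply]
    ring
  rw [hexp, hsymm]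
  ring

/-- The laws of the two-point motion started from `ρ ⊗ ρ` are tight, as their marginals are `ρ`;
since correlations converge, each of their limit points is invariant. -/
theorem exists_invariant_limit [CompleteSpace E] (hmix : Φ.StronglyMixing ρ)
    (𝒰 : Ultrafilter ℝ≥0) (h𝒰 : (𝒰 : Filter ℝ≥0) ≤ atTop) :
    ∃ π : Measure (E × E), IsProbabilityMeasure π ∧ (∀ s, Φ.pairLaw e s π = π) ∧
      ∀ F : E × E →ᵇ ℝ,
        Tendsto (fun t : ℝ≥0 => ∫ z, F z ∂(Φ.pairLaw e t (ρ.prod ρ))) 𝒰 (𝓝 (∫ z, F z ∂π)) := by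
  have := hmix.1
  have hwc := hmix.weaklyComplete
  let Q : ℝ≥0 → ProbabilityMeasure (E × E) := fun t => ⟨Φ.pairLaw e t (ρ.prod ρ), inferInstance⟩
  have htight : IsTightMeasureSet {((μ : ProbabilityMeasure (E × E)) : Measure (E × E)) |
      μ ∈ range Q} := by
    have hρ : IsTightMeasureSet ({ρ} : Set (Measure E)) := isTightMeasureSet_singleton
    refine IsTightMeasureSet.prodMk (hρ.subset ?_) (hρ.subset ?_)
    · rintro _ ⟨_, ⟨_, ⟨t, rfl⟩, rfl⟩, rfl⟩
      change (Φ.pairLaw e t (ρ.prod ρ)).fst = ρ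
      rw [fst_pairLaw, Measure.fst_prod, hmix.map_flow]
    · rintro _ ⟨_, ⟨_, ⟨t, rfl⟩, rfl⟩, rfl⟩
      change (Φ.pairLaw e t (ρ.prod ρ)).snd = ρ
      rw [snd_pairLaw, Measure.snd_prod, hmix.map_flow]
  obtain ⟨π, -, hπ⟩ := (isCompact_closure_of_isTightMeasureSet htight).ultrafilter_le_nhds'
    (𝒰.map Q) (Filter.mem_of_superset (Filter.mem_map.2 (by simp)) subset_closure)
  have hlim : ∀ F : E × E →ᵇ ℝ, Tendsto (fun t : ℝ≥0 => ∫ z, F z ∂(Φ.pairLaw e t (ρ.prod ρ)))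
      𝒰 (𝓝 (∫ z, F z ∂(π : Measure (E × E)))) :=
    ProbabilityMeasure.tendsto_iff_forall_integral_tendsto.1 (show Tendsto Q 𝒰 (𝓝 π) from hπ)
  refine ⟨π, inferInstance, fun s => ?_, hlim⟩
  refine Measure.ext_of_integral_mul_boundedContinuousFunction fun f g => ?_
  obtain ⟨l, hl⟩ := exists_tendsto_integral_tensor (e := e) hmix f g
  have h1 : ∫ z, tensor f g z ∂(π : Measure (E × E)) = l :=
    tendsto_nhds_unique (hlim _) (hl.mono_left h𝒰)
  have h2 : ∫ z, tensor f g z ∂(Φ.pairLaw e s π) = l := by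
    rw [integral_pairLaw hwc]
    refine tendsto_nhds_unique (hlim _)
      (((hl.comp (tendsto_add_const_atTop s)).mono_left h𝒰).congr fun t => ?_)
    rw [← integral_pairLaw hwc, pairLaw_pairLaw hwc, Function.comp_apply, add_comm]
  exact h2.trans h1.symm

end WhiteNoiseRDS

namespace WhiteNoiseRDS

/-! ### Invariant laws of the two-point motion live on the diagonal -/

variable {Ω E : Type*} [mΩ : MeasurableSpace Ω] [MetricSpace E] [mE : MeasurableSpace E]
  {P : Measure Ω} {Φ : WhiteNoiseRDS Ω E P} {e : E}
  [IsProbabilityMeasure P] [SecondCountableTopology E] [BorelSpace E]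
  {π : Measure (E × E)} [IsProbabilityMeasure π]

omit [SecondCountableTopology E] [BorelSpace E] in
theorem pairLaw_apply (s : ℝ≥0) {A : Set (E × E)} (hA : MeasurableSet A) :
    Φ.pairLaw e s π A = ∫⁻ z, P {ω | Φ.pairFlow e s ω z ∈ A} ∂π := by
  rw [pairLaw, Measure.map_apply (measurable_pairFlow s) hA,
    Measure.prod_apply_symm (measurable_pairFlow s hA)]
  rfl

omit [SecondCountableTopology E] [BorelSpace E] in
theorem measurable_measure_pairFlow_mem (s : ℝ≥0) {A : Set (E × E)} (hA : MeasurableSet A) :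
    Measurable fun z => P {ω | Φ.pairFlow e s ω z ∈ A} :=
  measurable_measure_prodMk_right (measurable_pairFlow s hA)

omit [SecondCountableTopology E] [BorelSpace E] in
theorem ae_ae_pairFlow (hinv : ∀ s, Φ.pairLaw e s π = π) (s : ℝ≥0) {q : E × E → Prop}
    (hqm : MeasurableSet {z | q z}) (hq : ∀ᵐ z ∂π, q z) :
    ∀ᵐ z ∂π, ∀ᵐ ω ∂P, q (Φ.pairFlow e s ω z) := by
  rw [← hinv s, pairLaw, ae_map_iff (measurable_pairFlow s).aemeasurable hqm] at hq
  exact (Measure.ae_ae_comm (p := fun ω z => q (Φ.pairFlow e s ω z))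
    (measurable_pairFlow s hqm)).1 (Measure.ae_ae_of_ae_prod hq)

/-- The diagonal is absorbing, so that an invariant law cannot let mass flow into it. -/
theorem ae_ae_pairFlow_ne (hinv : ∀ s, Φ.pairLaw e s π = π) (s : ℝ≥0) :
    ∀ᵐ z ∂π, z.1 ≠ z.2 → ∀ᵐ ω ∂P, Φ.flow e s ω z.1 ≠ Φ.flow e s ω z.2 := by
  have hΔ : MeasurableSet (diagonal E) := measurableSet_diagonal
  have hm := measurable_measure_pairFlow_mem (Φ := Φ) (e := e) (P := P) s hΔ
  have h1 := pairLaw_apply (Φ := Φ) (e := e) (π := π) s hΔ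
  rw [hinv, ← lintegral_add_compl _ hΔ] at h1
  have h2 : ∫⁻ z in diagonal E, P {ω | Φ.pairFlow e s ω z ∈ diagonal E} ∂π = π (diagonal E) := by
    rw [← setLIntegral_one]
    refine setLIntegral_congr_fun hΔ fun z hz => ?_
    have : {ω | Φ.pairFlow e s ω z ∈ diagonal E} = univ := by
      ext ω
      have hz' : z.1 = z.2 := hz
      simp [pairFlow, mem_diagonal_iff, hz']
    rw [this, measure_univ]
  have h3 : ∫⁻ z in (diagonal E)ᶜ, P {ω | Φ.pairFlow e s ω z ∈ diagonal E} ∂π = 0 := by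
    rw [h2] at h1
    exact (ENNReal.add_right_inj (measure_ne_top π (diagonal E))).1
      (by rw [add_zero]; exact h1.symm)
  rw [lintegral_eq_zero_iff hm, EventuallyEq, ae_restrict_iff' hΔ.compl] at h3
  filter_upwards [h3] with z hz hne
  have := hz hne
  rw [ae_iff]
  simpa [pairFlow, mem_diagonal_iff] using this

/-- The mass that the two-point motion carries from off-diagonal pairs in `U × U` to pairs at
distance less than `ε` stays off the diagonal; Fatou's lemma bounds it below. -/
theorem measure_mul_le_of_weaklyAsymptoticallyStable (hwc : Φ.WeaklyComplete)
    (hinv : ∀ s, Φ.pairLaw e s π = π) {U : Set E} (hU : MeasurableSet U) {t : ℕ → ℝ≥0}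
    {M : Set Ω}
    (hM : ∀ x ∈ U, ∀ y ∈ U, ∀ ε : ℝ≥0∞, 0 < ε →
      Tendsto (fun n => P {ω | ω ∈ M ∧ ε ≤ dist' (Φ.φ (t n) ω (some x)) (Φ.φ (t n) ω (some y))})
        atTop (𝓝 0)) {ε : ℝ≥0∞} (hε : 0 < ε) :
    P M * π {z | z.1 ≠ z.2 ∧ z.1 ∈ U ∧ z.2 ∈ U} ≤ π {z | z.1 ≠ z.2 ∧ edist z.1 z.2 < ε} := by
  have hΔ : MeasurableSet {z : E × E | z.1 ≠ z.2} := measurableSet_diagonal.compl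
  have hW : MeasurableSet {z : E × E | z.1 ≠ z.2 ∧ z.1 ∈ U ∧ z.2 ∈ U} :=
    hΔ.inter ((measurable_fst hU).inter (measurable_snd hU))
  have hlt : MeasurableSet {z : E × E | edist z.1 z.2 < ε} :=
    measurableSet_lt (measurable_fst.edist measurable_snd) measurable_const
  set W := {z : E × E | z.1 ≠ z.2 ∧ z.1 ∈ U ∧ z.2 ∈ U}
  let g (n : ℕ) (z : E × E) : ℝ≥0∞ := P {ω | Φ.pairFlow e (t n) ω z ∈ {z | edist z.1 z.2 < ε}}
  have hg (n : ℕ) : Measurable (g n) := measurable_measure_pairFlow_mem (t n) hlt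
  have h1 (n : ℕ) : ∫⁻ z in W, g n z ∂π ≤ π {z | z.1 ≠ z.2 ∧ edist z.1 z.2 < ε} := by
    have h := pairLaw_apply (Φ := Φ) (e := e) (π := π) (t n) (hΔ.inter hlt)
    rw [hinv] at h
    refine le_trans (le_trans (setLIntegral_mono_ae' hW ?_) (setLIntegral_le_lintegral W _)) h.ge
    filter_upwards [ae_ae_pairFlow_ne hinv (t n)] with z hz hzW
    refine measure_mono_ae ?_
    filter_upwards [hz hzW.1] with ω hω hω'
    exact ⟨hω, hω'⟩
  have h2 : ∀ z ∈ W, P M ≤ liminf (fun n => g n z) atTop := by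
    intro z hz
    have hlim := hM z.1 hz.2.1 z.2 hz.2.2 ε hε
    have hsub := ENNReal.Tendsto.sub (tendsto_const_nhds (x := P M)) hlim
      (.inl (measure_ne_top P M))
    rw [tsub_zero] at hsub
    rw [← hsub.liminf_eq]
    refine liminf_le_liminf (.of_forall fun n => ?_)
    rw [tsub_le_iff_right]
    refine le_trans (measure_mono_ae ?_) (measure_union_le _ _)
    filter_upwards [hwc.some_flow e (t n) z.1, hwc.some_flow e (t n) z.2] with ω hω1 hω2 hωM
    rcases lt_or_ge (edist (Φ.flow e (t n) ω z.1) (Φ.flow e (t n) ω z.2)) ε with h | h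
    · exact .inl h
    · refine .inr ⟨hωM, ?_⟩
      rw [hω1, hω2]
      exact h
  calc P M * π W = ∫⁻ _ in W, P M ∂π := by rw [setLIntegral_const]
    _ ≤ ∫⁻ z in W, liminf (fun n => g n z) atTop ∂π := setLIntegral_mono' hW h2
    _ ≤ liminf (fun n => ∫⁻ z in W, g n z ∂π) atTop := lintegral_liminf_le hg
    _ ≤ _ := (liminf_le_liminf (.of_forall h1)).trans_eq (liminf_const _)

/-- On `U × U` the two points would come arbitrarily close with a probability bounded below, while
an invariant law gives little mass to close pairs off the diagonal. -/
theorem ae_not_mem_of_weaklyAsymptoticallyStable (hwc : Φ.WeaklyComplete)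
    (hinv : ∀ s, Φ.pairLaw e s π = π) {U : Set E} (hstab : Φ.WeaklyAsymptoticallyStable U) :
    ∀ᵐ z ∂π, ¬ (z.1 ≠ z.2 ∧ z.1 ∈ U ∧ z.2 ∈ U) := by
  obtain ⟨hUo, -, t, -, -, M, -, hMpos, hM⟩ := hstab
  have hlim : Tendsto (fun n : ℕ => π {z | z.1 ≠ z.2 ∧ edist z.1 z.2 < ((n : ℝ≥0∞) + 1)⁻¹})
      atTop (𝓝 (π (⋂ n : ℕ, {z | z.1 ≠ z.2 ∧ edist z.1 z.2 < ((n : ℝ≥0∞) + 1)⁻¹}))) := by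
    refine tendsto_measure_iInter_atTop (fun n => ?_) ?_ ⟨0, measure_ne_top _ _⟩
    · exact (measurableSet_diagonal.compl.inter (measurableSet_lt
        (measurable_fst.edist measurable_snd) measurable_const)).nullMeasurableSet
    · intro m n hmn z hz
      refine ⟨hz.1, hz.2.trans_le (ENNReal.inv_le_inv.2 ?_)⟩
      gcongr
  have hempty : (⋂ n : ℕ, {z : E × E | z.1 ≠ z.2 ∧ edist z.1 z.2 < ((n : ℝ≥0∞) + 1)⁻¹}) = ∅ := by
    rw [eq_empty_iff_forall_notMem]
    intro z hz
    rw [mem_iInter] at hz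
    obtain ⟨n, hn⟩ := ENNReal.exists_inv_nat_lt (edist_pos.2 (hz 0).1).ne'
    have h1 := ((hz n).2.trans_le (ENNReal.inv_le_inv.2 le_self_add)).trans hn
    exact lt_irrefl _ h1
  rw [hempty, measure_empty] at hlim
  have h0 : P M * π {z | z.1 ≠ z.2 ∧ z.1 ∈ U ∧ z.2 ∈ U} ≤ 0 :=
    ge_of_tendsto hlim (.of_forall fun n =>
      measure_mul_le_of_weaklyAsymptoticallyStable hwc hinv hUo.measurableSet hM (by simp))
  rw [ae_iff]
  simpa only [not_not, nonpos_iff_eq_zero, mul_eq_zero, hMpos.ne', false_or] using h0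

/-- Off the diagonal, an invariant law gives no mass to close pairs: swift transitivity would carry
them into `U × U`. -/
theorem exists_ae_le_dist (hwc : Φ.WeaklyComplete)
    (hinv : ∀ s, Φ.pairLaw e s π = π) {U : Set E} (hstab : Φ.WeaklyAsymptoticallyStable U)
    (hswift : Φ.PointwiseStronglySwiftTransitive) :
    ∃ r > 0, ∀ᵐ z ∂π, z.1 ≠ z.2 → r ≤ dist z.1 z.2 := by
  have hW := ae_not_mem_of_weaklyAsymptoticallyStable hwc hinv hstab
  obtain ⟨hUo, ⟨y, hy⟩, -⟩ := hstab
  obtain ⟨r, hr, hrU⟩ := Metric.isOpen_iff.1 hUo y hy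
  obtain ⟨t, -, ht⟩ := hswift
  refine ⟨r / 2, half_pos hr, ?_⟩
  filter_upwards [ae_ae_pairFlow_ne hinv t, ae_ae_pairFlow hinv t
    (measurableSet_diagonal.compl.inter ((measurable_fst hUo.measurableSet).inter
      (measurable_snd hUo.measurableSet))).compl hW] with z h1 h2 hne
  by_contra! hlt
  refine (ht z.1 z.2 hne y).ne' ?_
  rw [measure_eq_zero_iff_ae_notMem]
  filter_upwards [h1 hne, h2] with ω hω1 hω2 hω3
  have hmem (x : E) (hx : x ∈ ({z.1, z.2} : Set E)) : Φ.flow e t ω x ∈ U := by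
    obtain ⟨x', hx', hx''⟩ := hω3 (mem_image_of_mem (Φ.φ t ω)
      (show some x ∈ ({some z.1, some z.2} : Set (Option E)) by
        rcases hx with rfl | rfl <;> simp))
    rw [flow_eq_of_eq_some hx''.symm]
    exact hrU (Metric.ball_subset_ball (by linarith) hx')
  exact hω2 ⟨hω1, hmem _ (by simp), hmem _ (by simp)⟩

omit [IsProbabilityMeasure P] [SecondCountableTopology E] [BorelSpace E] in
/-- By right-continuity, two trajectories that come close do so at a time of a fixed countable
dense set. -/
theorem RightContinuous.exists_denseSeq_dist_lt (hrc : Φ.RightContinuous) {ω : Ω} {x y : E} {r : ℝ}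
    (hr : 0 < r) (h : liminf (fun t : ℝ≥0 => dist' (Φ.φ t ω (some x)) (Φ.φ t ω (some y))) atTop
      = 0) :
    ∃ n, dist (Φ.flow e (TopologicalSpace.denseSeq ℝ≥0 n) ω x)
      (Φ.flow e (TopologicalSpace.denseSeq ℝ≥0 n) ω y) < r := by
  have hfr : ∃ᶠ t : ℝ≥0 in atTop,
      dist' (Φ.φ t ω (some x)) (Φ.φ t ω (some y)) < ENNReal.ofReal r :=
    frequently_lt_of_liminf_lt (by isBoundedDefault) (by simpa [h] using hr)
  obtain ⟨t, ht⟩ := hfr.exists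
  rcases hx : Φ.φ t ω (some x) with _ | x'
  · simp [hx, dist'] at ht
  rcases hy : Φ.φ t ω (some y) with _ | y'
  · simp [hy, dist'] at ht
  rw [hx, hy, dist', edist_lt_ofReal] at ht
  have htend (x x' : E) (hx : Φ.φ t ω (some x) = some x') :
      Tendsto (fun s => Φ.flow e s ω x) (𝓝[>] t) (𝓝 x') := by
    have h2 : Tendsto (fun o : Option E => o.getD e) (Filter.map some (𝓝 x')) (𝓝 x') := by
      rw [tendsto_map'_iff]
      exact tendsto_id
    exact h2.comp (hrc ω x x' t hx)
  have hev := ((htend x x' hx).dist (htend y y' hy)).eventually_lt_const ht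
  obtain ⟨u, hu, hsub⟩ := (mem_nhdsGT_iff_exists_Ioo_subset).1 hev
  obtain ⟨n, hn⟩ := (TopologicalSpace.denseRange_denseSeq ℝ≥0).exists_mem_open isOpen_Ioo
    (nonempty_Ioo.2 hu)
  exact ⟨n, hsub hn⟩

/-- Every invariant law of the two-point motion is concentrated on the diagonal. -/
theorem ae_eq_of_pairLaw_eq (hrc : Φ.RightContinuous) (hwc : Φ.WeaklyComplete)
    (hinv : ∀ s, Φ.pairLaw e s π = π) {U : Set E} (hstab : Φ.WeaklyAsymptoticallyStable U)
    (hswift : Φ.PointwiseStronglySwiftTransitive)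
    (hliminf : ∀ x y : E, ∀ᵐ ω ∂P,
      liminf (fun t : ℝ≥0 => dist' (Φ.φ t ω (some x)) (Φ.φ t ω (some y))) atTop = 0) :
    ∀ᵐ z ∂π, z.1 = z.2 := by
  obtain ⟨r, hr, hle⟩ := exists_ae_le_dist hwc hinv hstab hswift
  have hqm : MeasurableSet {z : E × E | z.1 ≠ z.2 → r ≤ dist z.1 z.2} := by
    have : {z : E × E | z.1 ≠ z.2 → r ≤ dist z.1 z.2} = diagonal E ∪ {z | r ≤ dist z.1 z.2} := by
      ext z
      simp [or_iff_not_imp_left]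
    rw [this]
    exact measurableSet_diagonal.union
      (measurableSet_le measurable_const (measurable_fst.dist measurable_snd))
  have h1 : ∀ᵐ z ∂π, ∀ n, z.1 ≠ z.2 → ∀ᵐ ω ∂P,
      Φ.flow e (TopologicalSpace.denseSeq ℝ≥0 n) ω z.1
        ≠ Φ.flow e (TopologicalSpace.denseSeq ℝ≥0 n) ω z.2 :=
    ae_all_iff.2 fun n => ae_ae_pairFlow_ne hinv _
  have h2 : ∀ᵐ z ∂π, ∀ n, ∀ᵐ ω ∂P, Φ.flow e (TopologicalSpace.denseSeq ℝ≥0 n) ω z.1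
        ≠ Φ.flow e (TopologicalSpace.denseSeq ℝ≥0 n) ω z.2 →
      r ≤ dist (Φ.flow e (TopologicalSpace.denseSeq ℝ≥0 n) ω z.1)
        (Φ.flow e (TopologicalSpace.denseSeq ℝ≥0 n) ω z.2) :=
    ae_all_iff.2 fun n => ae_ae_pairFlow hinv _ hqm hle
  -- off the diagonal the two trajectories would stay at distance at least `r` at all dense times
  filter_upwards [h1, h2] with z hz1 hz2
  by_contra hne
  have h3 := ae_all_iff.2 fun n => hz1 n hne
  have h4 := ae_all_iff.2 hz2
  obtain ⟨ω, hω3, hω4, hω5⟩ := (h3.and (h4.and (hliminf z.1 z.2))).exists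
  obtain ⟨n, hn⟩ := hrc.exists_denseSeq_dist_lt (e := e) hr hω5
  exact (hω4 n (hω3 n)).not_gt hn

end WhiteNoiseRDS

/-! ### Synchronization in mean -/

/-- The truncated distance `min 1 (dist x y)`. -/
noncomputable def truncDist (E : Type*) [MetricSpace E] : E × E →ᵇ ℝ :=
  BoundedContinuousFunction.ofNormedAddCommGroup (fun z => min 1 (dist z.1 z.2)) (by fun_prop) 1
    (fun z => by
      rw [Real.norm_eq_abs, abs_of_nonneg (le_min zero_le_one dist_nonneg)]
      exact min_le_left _ _)

section TruncDist

variable {E : Type*} [MetricSpace E]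

theorem truncDist_apply (x y : E) : truncDist E (x, y) = min 1 (dist x y) := rfl

theorem truncDist_nonneg (z : E × E) : 0 ≤ truncDist E z := le_min zero_le_one dist_nonneg

theorem truncDist_le_one (z : E × E) : truncDist E z ≤ 1 := min_le_left _ _

theorem norm_truncDist_le_one (z : E × E) : ‖truncDist E z‖ ≤ 1 := by
  rw [Real.norm_eq_abs, abs_of_nonneg (truncDist_nonneg z)]
  exact truncDist_le_one z

theorem truncDist_comm (x y : E) : truncDist E (x, y) = truncDist E (y, x) := by
  rw [truncDist_apply, truncDist_apply, dist_comm]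

theorem truncDist_triangle (x y z : E) :
    truncDist E (x, z) ≤ truncDist E (x, y) + truncDist E (y, z) := by
  simp only [truncDist_apply]
  have := dist_triangle x y z
  have h1 : 0 ≤ dist x y := dist_nonneg
  have h2 : 0 ≤ dist y z := dist_nonneg
  rcases min_cases 1 (dist x y) with h | h <;> rcases min_cases 1 (dist y z) with h' | h' <;>
    rcases min_cases 1 (dist x z) with h'' | h'' <;> linarith

theorem truncDist_eq_zero {x y : E} : truncDist E (x, y) = 0 ↔ x = y := by
  rw [truncDist_apply, ← dist_eq_zero (x := x)]
  constructor
  · intro h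
    rcases min_cases 1 (dist x y) with h' | h' <;> linarith
  · intro h
    simp [h]

variable [MeasurableSpace E] [SecondCountableTopology E] [BorelSpace E]

theorem measurable_truncDist {X : Type*} [MeasurableSpace X] {f g : X → E} (hf : Measurable f)
    (hg : Measurable g) : Measurable fun x => truncDist E (f x, g x) :=
  (truncDist E).continuous.measurable.comp (hf.prodMk hg)

theorem integrable_truncDist {X : Type*} [MeasurableSpace X] {μ : Measure X} [IsFiniteMeasure μ]
    {f g : X → E} (hf : Measurable f)
    (hg : Measurable g) : Integrable (fun x => truncDist E (f x, g x)) μ :=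
  Integrable.of_bound (measurable_truncDist hf hg).aestronglyMeasurable 1
    (.of_forall fun _ => norm_truncDist_le_one _)

end TruncDist

namespace WhiteNoiseRDS

variable {Ω E : Type*} [mΩ : MeasurableSpace Ω] [MetricSpace E] [mE : MeasurableSpace E]
  {P : Measure Ω} {Φ : WhiteNoiseRDS Ω E P} {e : E}
  [IsProbabilityMeasure P] [SecondCountableTopology E] [BorelSpace E] {ρ : Measure E}

/-- Weak synchronization in mean: two independent `ρ`-distributed points, driven by the same noise,
approach each other. -/
def SyncInMean (Φ : WhiteNoiseRDS Ω E P) (ρ : Measure E) : Prop :=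
  ∀ e : E, Tendsto (fun t : ℝ≥0 => ∫ z, truncDist E z ∂(Φ.pairLaw e t (ρ.prod ρ))) atTop (𝓝 0)

theorem syncInMean [CompleteSpace E] (hrc : Φ.RightContinuous) (hmix : Φ.StronglyMixing ρ)
    {U : Set E} (hstab : Φ.WeaklyAsymptoticallyStable U)
    (hswift : Φ.PointwiseStronglySwiftTransitive)
    (hliminf : ∀ x y : E, ∀ᵐ ω ∂P,
      liminf (fun t : ℝ≥0 => dist' (Φ.φ t ω (some x)) (Φ.φ t ω (some y))) atTop = 0) :
    Φ.SyncInMean ρ := by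
  intro e
  rw [tendsto_iff_ultrafilter]
  intro 𝒰 h𝒰
  obtain ⟨π, hπ, hinv, hlim⟩ := exists_invariant_limit (e := e) hmix 𝒰 h𝒰
  have h := ae_eq_of_pairLaw_eq hrc hmix.weaklyComplete hinv hstab hswift hliminf
  have h0 : ∫ z, truncDist E z ∂π = 0 := by
    refine integral_eq_zero_of_ae ?_
    filter_upwards [h] with z hz using truncDist_eq_zero.2 hz
  rw [← h0]
  exact hlim _

/-! ### Pullback convergence to a random point -/

variable (Φ) in
/-- The position at time `0` of the trajectory started from `x` at time `-t`. -/
def pullback (e : E) (t : ℝ≥0) (ω : Ω) (x : E) : E := Φ.flow e t (Φ.θ (-t) ω) x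

omit [IsProbabilityMeasure P] [SecondCountableTopology E] [BorelSpace E] in
theorem measurable_pullback_𝓕 (t : ℝ≥0) :
    @Measurable _ _ ((Φ.𝓕 (-t) 0).prod mE) _ (fun p : Ω × E => Φ.pullback e t p.1 p.2) := by
  have := measurable_flow_θ_𝓕 (Φ := Φ) (e := e) t (-t)
  rwa [add_neg_cancel] at this

omit [IsProbabilityMeasure P] [SecondCountableTopology E] [BorelSpace E] in
theorem measurable_pullback (t : ℝ≥0) :
    Measurable (fun p : Ω × E => Φ.pullback e t p.1 p.2) :=
  (measurable_flow t).comp (((measurable_θ' _).comp measurable_fst).prodMk measurable_snd)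

omit [IsProbabilityMeasure P] [SecondCountableTopology E] [BorelSpace E] in
theorem measurable_pullback_left (t : ℝ≥0) (x : E) :
    Measurable (fun ω => Φ.pullback e t ω x) :=
  (measurable_pullback t).comp measurable_prodMk_right

omit [IsProbabilityMeasure P] [SecondCountableTopology E] [BorelSpace E] in
theorem 𝓕_le_past (s : ℝ≥0) : Φ.𝓕 (-s) 0 ≤ Φ.past 0 :=
  le_iSup₂_of_le (f := fun (s : ℝ) (_ : s ≤ 0) => Φ.𝓕 s 0) (-s : ℝ) (by simp) le_rfl

omit [IsProbabilityMeasure P] [SecondCountableTopology E] [BorelSpace E] in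
theorem past_le : Φ.past 0 ≤ mΩ := iSup₂_le fun s hs => Φ.𝓕_le s 0 hs

omit [IsProbabilityMeasure P] [SecondCountableTopology E] [BorelSpace E] in
theorem measurable_pullback_left_past (t : ℝ≥0) (x : E) :
    Measurable[Φ.past 0] (fun ω => Φ.pullback e t ω x) := by
  have h : Measurable[Φ.𝓕 (-t) 0] (fun ω => Φ.pullback e t ω x) :=
    @Measurable.comp _ _ _ (Φ.𝓕 (-t) 0) ((Φ.𝓕 (-t) 0).prod mE) _ _ _ (measurable_pullback_𝓕 t)
      (@measurable_prodMk_right _ _ (Φ.𝓕 (-t) 0) _ _)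
  exact h.mono (𝓕_le_past t) le_rfl

omit [IsProbabilityMeasure P] [SecondCountableTopology E] [BorelSpace E] in
theorem integral_comp_θ (r : ℝ) {f : Ω → ℝ} (hf : Measurable f) :
    ∫ ω, f (Φ.θ r ω) ∂P = ∫ ω, f ω ∂P := by
  conv_rhs => rw [← Φ.map_θ r]
  rw [integral_map (measurable_θ' r).aemeasurable hf.aestronglyMeasurable]

omit [SecondCountableTopology E] [BorelSpace E] in
theorem integral_prod_comp_θ {S : Type*} [MeasurableSpace S] (ν : Measure S)
    [IsProbabilityMeasure ν] (r : ℝ) {f : Ω × S → ℝ} (hf : Measurable f) :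
    ∫ p, f (Φ.θ r p.1, p.2) ∂(P.prod ν) = ∫ p, f p ∂(P.prod ν) := by
  have hf' : Measurable (fun p : Ω × S => f (Φ.θ r p.1, p.2)) :=
    hf.comp (((measurable_θ' r).comp measurable_fst).prodMk measurable_snd)
  have h := congrArg (fun m => ∫ y, id y ∂m) (map_prod_θ (Φ := Φ) r ν hf)
  rwa [integral_map hf'.aemeasurable aestronglyMeasurable_id,
    integral_map hf.aemeasurable aestronglyMeasurable_id] at h

/-- The mean truncated distance, at time `0`, of the trajectories started from `x` at time
`-(s + r)` and from a `ρ`-distributed point at time `-s`. -/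
theorem integral_truncDist_pullback [IsProbabilityMeasure ρ] (hwc : Φ.WeaklyComplete)
    (s r : ℝ≥0) (x : E) :
    ∫ p, truncDist E (Φ.pullback e (s + r) p.1 x, Φ.pullback e s p.1 p.2) ∂(P.prod ρ)
      = ∫ z, pairOp hwc e s (truncDist E) z ∂((P.map fun ω => Φ.flow e r ω x).prod ρ) := by
  have hprob : IsProbabilityMeasure (P.map fun ω => Φ.flow e r ω x) :=
    Measure.isProbabilityMeasure_map (measurable_flow_left r x).aemeasurable
  have hZ : @Measurable _ _ ((Φ.𝓕 0 r).prod mE) _ (fun p : Ω × E => (Φ.flow e r p.1 x, p.2)) :=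
    @Measurable.prodMk _ ((Φ.𝓕 0 r).prod mE) _ _ _ _ _ _
      ((measurable_flow_left_𝓕 r x).comp (@measurable_fst _ _ (Φ.𝓕 0 r) _))
      (@measurable_snd _ _ (Φ.𝓕 0 r) _)
  have hZ' : Measurable (fun p : Ω × E => (Φ.flow e r p.1 x, p.2)) :=
    ((measurable_flow_left r x).comp measurable_fst).prodMk measurable_snd
  have hlaw : (P.prod ρ).map (fun p : Ω × E => (Φ.flow e r p.1 x, p.2))
      = (P.map fun ω => Φ.flow e r ω x).prod ρ := by
    have h := Measure.map_prod_map P ρ (measurable_flow_left (Φ := Φ) (e := e) r x) measurable_id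
    rw [Measure.map_id] at h
    exact h.symm
  have hm : Measurable (fun p : Ω × E =>
      truncDist E (Φ.pullback e (s + r) p.1 x, Φ.pullback e s p.1 p.2)) :=
    measurable_truncDist ((measurable_pullback_left _ _).comp measurable_fst)
      (measurable_pullback s)
  have hpm : Measurable (fun p : Ω × E =>
      Φ.pairFlow e s (Φ.θ r p.1) (Φ.flow e r p.1 x, p.2)) :=
    (measurable_pairFlow s).comp (((measurable_θ' r).comp measurable_fst).prodMk hZ')
  rw [← integral_pairLaw hwc, ← hlaw, ← map_pairFlow_θ ρ s r hZ,
    ← integral_prod_comp_θ (Φ := Φ) ρ (s + r) hm, integral_map hpm.aemeasurable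
      (truncDist E).continuous.measurable.aestronglyMeasurable]
  refine integral_congr_ae ?_
  have h1 : ∀ᵐ p ∂(P.prod ρ), Φ.flow e (s + r) p.1 x
      = Φ.flow e s (Φ.θ r p.1) (Φ.flow e r p.1 x) :=
    Measure.quasiMeasurePreserving_fst.ae (flow_add hwc s r x)
  filter_upwards [h1] with p hp
  have h2 : Φ.θ (-((s + r : ℝ≥0) : ℝ)) (Φ.θ (s + r) p.1) = p.1 := by
    push_cast
    exact θ_neg_θ _ _
  have h3 : Φ.θ (-(s : ℝ)) (Φ.θ (s + r) p.1) = Φ.θ r p.1 := by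
    rw [← Φ.θ_add]
    congr 1
    ring
  simp only [pullback, h2, h3, hp, pairFlow]

/-- By strong mixing, the starting point `x` may be replaced by an independent `ρ`-distributed one
as its starting time recedes to `-∞`. -/
theorem tendsto_integral_truncDist_pullback (hmix : Φ.StronglyMixing ρ) (s : ℝ≥0) (x : E) :
    Tendsto (fun t : ℝ≥0 =>
        ∫ p, truncDist E (Φ.pullback e t p.1 x, Φ.pullback e s p.1 p.2) ∂(P.prod ρ)) atTop
      (𝓝 (∫ z, truncDist E z ∂(Φ.pairLaw e s (ρ.prod ρ)))) := by
  have := hmix.1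
  have hwc := hmix.weaklyComplete
  have hcont : Continuous fun z : E => ∫ y, pairOp hwc e s (truncDist E) (z, y) ∂ρ :=
    continuous_of_dominated (bound := fun _ => ‖pairOp hwc e s (truncDist E)‖)
      (fun z => ((pairOp hwc e s (truncDist E)).continuous.comp
        (Continuous.prodMk_right z)).measurable.aestronglyMeasurable)
      (fun z => .of_forall fun y => BoundedContinuousFunction.norm_coe_le_norm _ _)
      (integrable_const _)
      (.of_forall fun y => (pairOp hwc e s (truncDist E)).continuous.comp
        (Continuous.prodMk_left y))
  let g : E →ᵇ ℝ := BoundedContinuousFunction.ofNormedAddCommGroup _ hcont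
    ‖pairOp hwc e s (truncDist E)‖ (fun z => by
      simpa using norm_integral_le_of_norm_le_const (μ := ρ)
        (C := ‖pairOp hwc e s (truncDist E)‖)
        (f := fun y => pairOp hwc e s (truncDist E) (z, y))
        (.of_forall fun y => BoundedContinuousFunction.norm_coe_le_norm _ _))
  have hg (ν : Measure E) [IsProbabilityMeasure ν] :
      ∫ z, pairOp hwc e s (truncDist E) z ∂(ν.prod ρ) = ∫ z, g z ∂ν :=
    integral_prod _ (BoundedContinuousFunction.integrable _ _)
  have h1 := hmix.tendsto_integral_flow (e := e) g x
  rw [← hg, ← integral_pairLaw] at h1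
  have hsub : Tendsto (fun t : ℝ≥0 => t - s) atTop atTop :=
    tendsto_atTop.2 fun b => (eventually_ge_atTop (b + s)).mono fun t ht =>
      le_tsub_of_add_le_right ht
  refine (h1.comp hsub).congr' ?_
  filter_upwards [eventually_ge_atTop s] with t ht
  obtain ⟨r, rfl⟩ := exists_add_of_le ht
  have hprob : IsProbabilityMeasure (P.map fun ω => Φ.flow e r ω x) :=
    Measure.isProbabilityMeasure_map (measurable_flow_left r x).aemeasurable
  rw [integral_truncDist_pullback hwc, hg, Function.comp_apply, add_tsub_cancel_left,
    integral_map (measurable_flow_left r x).aemeasurable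
      g.continuous.measurable.aestronglyMeasurable]

theorem integral_truncDist_le [IsProbabilityMeasure ρ] {Y Y' : Ω → E} (hY : Measurable Y)
    (hY' : Measurable Y') {Z : Ω × E → E} (hZ : Measurable Z) :
    ∫ ω, truncDist E (Y ω, Y' ω) ∂P ≤ ∫ p, truncDist E (Y p.1, Z p) ∂(P.prod ρ)
      + ∫ p, truncDist E (Y' p.1, Z p) ∂(P.prod ρ) := by
  have h1 : Integrable (fun p : Ω × E => truncDist E (Y p.1, Z p)) (P.prod ρ) :=
    integrable_truncDist (hY.comp measurable_fst) hZ
  have h2 : Integrable (fun p : Ω × E => truncDist E (Y' p.1, Z p)) (P.prod ρ) :=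
    integrable_truncDist (hY'.comp measurable_fst) hZ
  have h3 : Integrable (fun p : Ω × E => truncDist E (Y p.1, Y' p.1)) (P.prod ρ) :=
    integrable_truncDist (hY.comp measurable_fst) (hY'.comp measurable_fst)
  have h4 : ∫ ω, truncDist E (Y ω, Y' ω) ∂P
      = ∫ p, truncDist E (Y p.1, Y' p.1) ∂(P.prod ρ) := by
    rw [integral_prod _ h3]
    simp
  rw [h4, ← integral_add h1 h2]
  refine integral_mono h3 (h1.add h2) fun p => ?_
  refine (truncDist_triangle _ (Z p) _).trans_eq ?_
  rw [truncDist_comm (Z p)]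

/-- The pullback trajectories of a point are Cauchy in probability. -/
theorem exists_forall_integral_truncDist_le (hmix : Φ.StronglyMixing ρ) (hsync : Φ.SyncInMean ρ)
    (x : E) {ε : ℝ} (hε : 0 < ε) :
    ∃ T : ℝ≥0, ∀ t ≥ T, ∀ t' ≥ T,
      ∫ ω, truncDist E (Φ.pullback e t ω x, Φ.pullback e t' ω x) ∂P ≤ ε := by
  have := hmix.1
  obtain ⟨s, hs⟩ := ((hsync e).eventually_lt_const (half_pos hε)).exists
  obtain ⟨T, hT⟩ := eventually_atTop.1
    ((tendsto_integral_truncDist_pullback (e := e) hmix s x).eventually_lt_const hs)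
  refine ⟨T, fun t ht t' ht' => ?_⟩
  have := integral_truncDist_le (P := P) (ρ := ρ)
    (measurable_pullback_left (Φ := Φ) (e := e) (P := P) t x)
    (measurable_pullback_left (Φ := Φ) (e := e) (P := P) t' x)
    (measurable_pullback (Φ := Φ) (e := e) (P := P) s)
  linarith [hT t ht, hT t' ht']

theorem ae_exists_tendsto_of_integral_truncDist_le [CompleteSpace E] {Y : ℕ → Ω → E}
    (hY : ∀ n, Measurable (Y n))
    (h : ∀ n, ∫ ω, truncDist E (Y n ω, Y (n + 1) ω) ∂P ≤ (1 / 2) ^ n) :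
    ∀ᵐ ω ∂P, ∃ y, Tendsto (fun n => Y n ω) atTop (𝓝 y) := by
  have hm (n : ℕ) : Measurable fun ω => ENNReal.ofReal (truncDist E (Y n ω, Y (n + 1) ω)) :=
    (measurable_truncDist (hY n) (hY (n + 1))).ennreal_ofReal
  have h1 : ∫⁻ ω, ∑' n, ENNReal.ofReal (truncDist E (Y n ω, Y (n + 1) ω)) ∂P ≠ ⊤ := by
    rw [lintegral_tsum fun n => (hm n).aemeasurable]
    refine ne_top_of_le_ne_top (ENNReal.ofReal_ne_top (r := ∑' n : ℕ, (1 / 2 : ℝ) ^ n)) ?_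
    rw [ENNReal.ofReal_tsum_of_nonneg (fun n => by positivity) summable_geometric_two]
    refine ENNReal.tsum_le_tsum fun n => ?_
    rw [← ofReal_integral_eq_lintegral_ofReal (integrable_truncDist (hY n) (hY (n + 1)))
      (.of_forall fun ω => truncDist_nonneg _)]
    exact ENNReal.ofReal_le_ofReal (h n)
  filter_upwards [ae_lt_top (Measurable.tsum hm) h1] with ω hω
  have hsum : Summable fun n => truncDist E (Y n ω, Y (n + 1) ω) := by
    have := ENNReal.summable_toReal hω.ne
    simpa only [ENNReal.toReal_ofReal (truncDist_nonneg _)] using this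
  have hev : (fun n => truncDist E (Y n ω, Y (n + 1) ω)) =ᶠ[atTop]
      fun n => dist (Y n ω) (Y (n + 1) ω) := by
    -- the terms of the convergent series are eventually less than `1`, hence not truncated
    filter_upwards [hsum.tendsto_atTop_zero.eventually_lt_const one_pos] with n hn
    rw [truncDist_apply] at hn ⊢
    exact min_eq_right (by by_contra! hlt; rw [min_eq_left hlt.le] at hn; exact lt_irrefl _ hn)
  have hsum' : Summable fun n => dist (Y n ω) (Y (n + 1) ω) :=
    (summable_congr_atTop hev).1 hsum
  exact cauchySeq_tendsto_of_complete (cauchySeq_of_summable_dist hsum')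

/-- The pullback trajectories converge to one and the same random point, which only depends on the
past of the noise. -/
theorem exists_pullback_limit [CompleteSpace E] (hmix : Φ.StronglyMixing ρ)
    (hsync : Φ.SyncInMean ρ) (e : E) :
    ∃ a : Ω → E, Measurable[Φ.past 0] a ∧
      (∃ τ : ℕ → ℝ≥0, Tendsto τ atTop atTop ∧
        ∀ᵐ ω ∂P, Tendsto (fun n => Φ.pullback e (τ n) ω e) atTop (𝓝 (a ω))) ∧
      ∀ x : E, Tendsto (fun t : ℝ≥0 => ∫ ω, truncDist E (Φ.pullback e t ω x, a ω) ∂P)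
        atTop (𝓝 0) := by
  have := hmix.1
  have : Nonempty E := ⟨e⟩
  choose T hT using fun n : ℕ => exists_forall_integral_truncDist_le (e := e) hmix hsync e
    (show (0 : ℝ) < (1 / 2) ^ n by positivity)
  -- a time sequence which is monotone, tends to infinity and dominates `T`
  let τ : ℕ → ℝ≥0 := fun n => n + ∑ i ∈ Finset.range (n + 1), T i
  have hτT (n : ℕ) : T n ≤ τ n :=
    (Finset.single_le_sum (f := T) (fun i _ => zero_le) (Finset.self_mem_range_succ n)).trans
      le_add_self
  have hτmono (n : ℕ) : τ n ≤ τ (n + 1) := by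
    simp only [τ, Finset.sum_range_succ _ (n + 1)]
    push_cast
    exact add_le_add le_self_add le_self_add
  have hτ : Tendsto τ atTop atTop :=
    tendsto_atTop_mono (fun n => le_self_add) tendsto_natCast_atTop_atTop
  have hconv := ae_exists_tendsto_of_integral_truncDist_le
    (fun n => measurable_pullback_left (Φ := Φ) (e := e) (P := P) (τ n) e)
    (fun n => hT n _ (hτT n) _ ((hτT n).trans (hτmono n)))
  let a : Ω → E := fun ω => limUnder atTop (fun n => Φ.pullback e (τ n) ω e)
  have ha : Measurable[Φ.past 0] a :=
    (@StronglyMeasurable.limUnder ℕ Ω E (Φ.past 0) _ _ _ _ _ _ _ fun n =>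
      (measurable_pullback_left_past (τ n) e).stronglyMeasurable).measurable
  have ha' : Measurable a := ha.mono past_le le_rfl
  have hlim : ∀ᵐ ω ∂P, Tendsto (fun n => Φ.pullback e (τ n) ω e) atTop (𝓝 (a ω)) := by
    filter_upwards [hconv] with ω hω using tendsto_nhds_limUnder hω
  refine ⟨a, ha, ⟨τ, hτ, hlim⟩, fun x => ?_⟩
  -- the starting point `x` is compared with `a` through a `ρ`-distributed point started at `-s`
  have hL (s : ℝ≥0) : ∫ p, truncDist E (a p.1, Φ.pullback e s p.1 p.2) ∂(P.prod ρ)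
      = ∫ z, truncDist E z ∂(Φ.pairLaw e s (ρ.prod ρ)) := by
    refine tendsto_nhds_unique ?_ ((tendsto_integral_truncDist_pullback (e := e) hmix s e).comp hτ)
    refine tendsto_integral_of_dominated_convergence (fun _ => 1) (fun n => ?_)
      (integrable_const _) (fun n => .of_forall fun _ => norm_truncDist_le_one _) ?_
    · exact (measurable_truncDist ((measurable_pullback_left _ _).comp measurable_fst)
        (measurable_pullback s)).aestronglyMeasurable
    · have hlim' : ∀ᵐ p ∂(P.prod ρ),
          Tendsto (fun n => Φ.pullback e (τ n) p.1 e) atTop (𝓝 (a p.1)) :=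
        Measure.quasiMeasurePreserving_fst.ae hlim
      filter_upwards [hlim'] with p hp
      exact ((truncDist E).continuous.tendsto _).comp (hp.prodMk_nhds tendsto_const_nhds)
  rw [Metric.tendsto_atTop]
  intro ε hε
  obtain ⟨s, hs⟩ := ((hsync e).eventually_lt_const (half_pos hε)).exists
  obtain ⟨T, hT⟩ := eventually_atTop.1
    ((tendsto_integral_truncDist_pullback (e := e) hmix s x).eventually_lt_const hs)
  refine ⟨T, fun t ht => ?_⟩
  have h1 := integral_truncDist_le (P := P) (ρ := ρ)
    (measurable_pullback_left (Φ := Φ) (e := e) (P := P) t x) ha'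
    (measurable_pullback (Φ := Φ) (e := e) (P := P) s)
  rw [Real.dist_0_eq_abs, abs_of_nonneg (integral_nonneg fun ω => truncDist_nonneg _)]
  linarith [hT t ht, hL s]

end WhiteNoiseRDS

/-! ### Convergence in probability and weak convergence to a point -/

section Convergence

variable {X E ι : Type*} [MeasurableSpace X] [MetricSpace E] [MeasurableSpace E]
  [SecondCountableTopology E] [BorelSpace E] {l : Filter ι}

theorem tendsto_measure_le_edist_of_tendsto_integral {μ : Measure X} [IsProbabilityMeasure μ]
    {Y : ι → X → E} {Z : X → E} (hY : ∀ i, Measurable (Y i)) (hZ : Measurable Z)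
    (h : Tendsto (fun i => ∫ x, truncDist E (Y i x, Z x) ∂μ) l (𝓝 0)) {ε : ℝ≥0∞} (hε : 0 < ε) :
    Tendsto (fun i => μ {x | ε ≤ edist (Y i x) (Z x)}) l (𝓝 0) := by
  set δ : ℝ := (min 1 ε).toReal with hδdef
  have htop : min 1 ε ≠ ⊤ := ne_top_of_le_ne_top ENNReal.one_ne_top (min_le_left _ _)
  have hδ : 0 < δ := ENNReal.toReal_pos (lt_min one_pos hε).ne' htop
  have hsub (i : ι) : {x | ε ≤ edist (Y i x) (Z x)} ⊆ {x | δ ≤ truncDist E (Y i x, Z x)} := by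
    intro x hx
    rw [mem_ofPred_eq, truncDist_apply]
    refine le_min ?_ ?_
    · exact ENNReal.toReal_le_of_le_ofReal zero_le_one (by simp)
    · rw [hδdef, dist_edist]
      exact ENNReal.toReal_mono (edist_ne_top _ _) ((min_le_right _ _).trans hx)
  have hlim : Tendsto (fun i => ENNReal.ofReal ((∫ x, truncDist E (Y i x, Z x) ∂μ) / δ)) l
      (𝓝 0) := by
    simpa using ENNReal.tendsto_ofReal (h.div_const δ)
  refine tendsto_of_tendsto_of_tendsto_of_le_of_le tendsto_const_nhds hlim (fun _ => zero_le)
    fun i => ?_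
  refine (measure_mono (hsub i)).trans ?_
  rw [← ofReal_measureReal]
  refine ENNReal.ofReal_le_ofReal ?_
  rw [le_div_iff₀ hδ, mul_comm]
  exact mul_meas_ge_le_integral_of_nonneg (.of_forall fun _ => truncDist_nonneg _)
    (integrable_truncDist (hY i) hZ) δ

theorem tendsto_integral_of_tendsto_integral_truncDist {μ : Measure X} [IsProbabilityMeasure μ]
    {Y : ι → X → E} (hY : ∀ i, Measurable (Y i)) {b : E}
    (h : Tendsto (fun i => ∫ x, truncDist E (Y i x, b) ∂μ) l (𝓝 0)) (f : E →ᵇ ℝ) :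
    Tendsto (fun i => ∫ x, f (Y i x) ∂μ) l (𝓝 (f b)) := by
  rw [Metric.tendsto_nhds]
  intro ε hε
  obtain ⟨δ, hδ, hfδ⟩ := Metric.continuousAt_iff.1 f.continuous.continuousAt (ε / 2) (half_pos hε)
  have hδ' : 0 < min 1 δ := lt_min one_pos hδ
  set C := 2 * ‖f‖ / min 1 δ
  have hC : 0 ≤ C := by positivity
  -- near `b` continuity is used, away from `b` the truncated distance is at least `min 1 δ`
  have hbound (y : E) : |f y - f b| ≤ ε / 2 + C * truncDist E (y, b) := by
    rcases lt_or_ge (dist y b) δ with hy | hy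
    · have := hfδ hy
      rw [Real.dist_eq] at this
      have := mul_nonneg hC (truncDist_nonneg (y, b))
      linarith
    · have h1 : min 1 δ ≤ truncDist E (y, b) := min_le_min le_rfl hy
      have h2 : 2 * ‖f‖ ≤ C * truncDist E (y, b) := by
        calc 2 * ‖f‖ = C * min 1 δ := (div_mul_cancel₀ _ hδ'.ne').symm
          _ ≤ _ := mul_le_mul_of_nonneg_left h1 hC
      have h3 := f.dist_le_two_norm y b
      rw [Real.dist_eq] at h3
      linarith
  have hlim : Tendsto (fun i => ε / 2 + C * ∫ x, truncDist E (Y i x, b) ∂μ) l (𝓝 (ε / 2)) := by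
    simpa using (h.const_mul C).const_add (ε / 2)
  filter_upwards [hlim.eventually_lt_const (half_lt_self hε)] with i hi
  have hfi : Integrable (fun x => f (Y i x)) μ :=
    Integrable.of_bound (f.continuous.measurable.comp (hY i)).aestronglyMeasurable ‖f‖
      (.of_forall fun _ => f.norm_coe_le_norm _)
  have hti : Integrable (fun x => truncDist E (Y i x, b)) μ :=
    integrable_truncDist (hY i) measurable_const
  rw [Real.dist_eq]
  calc |∫ x, f (Y i x) ∂μ - f b| = |∫ x, (f (Y i x) - f b) ∂μ| := by
        rw [integral_sub hfi (integrable_const _)]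
        simp
    _ ≤ ∫ x, |f (Y i x) - f b| ∂μ := abs_integral_le_integral_abs
    _ ≤ ∫ x, (ε / 2 + C * truncDist E (Y i x, b)) ∂μ :=
        integral_mono (hfi.sub (integrable_const _)).abs
          ((integrable_const _).add (hti.const_mul C)) fun x => hbound _
    _ = ε / 2 + C * ∫ x, truncDist E (Y i x, b) ∂μ := by
        rw [integral_add (integrable_const _) (hti.const_mul C), integral_const_mul]
        simp
    _ < ε := hi

/-- Convergence of `μ` transported by `Y i` to the Dirac mass at `b` can be tested on the truncated
distances to the points of a dense sequence. -/
theorem tendsto_integral_of_forall_denseSeq [Nonempty E] {μ : Measure X} [IsProbabilityMeasure μ]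
    {Y : ι → X → E} (hY : ∀ i, Measurable (Y i)) {b : E}
    (h : ∀ k, Tendsto (fun i => ∫ x, truncDist E (Y i x, TopologicalSpace.denseSeq E k) ∂μ) l
      (𝓝 (truncDist E (b, TopologicalSpace.denseSeq E k)))) (f : E →ᵇ ℝ) :
    Tendsto (fun i => ∫ x, f (Y i x) ∂μ) l (𝓝 (f b)) := by
  refine tendsto_integral_of_tendsto_integral_truncDist hY ?_ f
  rw [Metric.tendsto_nhds]
  intro ε hε
  obtain ⟨k, hk⟩ := (TopologicalSpace.denseRange_denseSeq E).exists_mem_open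
    Metric.isOpen_ball ⟨b, Metric.mem_ball_self (half_pos hε)⟩
  set z := TopologicalSpace.denseSeq E k
  have hb : truncDist E (b, z) < ε / 2 := by
    rw [truncDist_comm]
    exact (min_le_right _ _).trans_lt hk
  filter_upwards [(h k).eventually_lt_const hb] with i hi
  rw [Real.dist_0_eq_abs, abs_of_nonneg (integral_nonneg fun ω => truncDist_nonneg _)]
  have hti : Integrable (fun x => truncDist E (Y i x, z)) μ :=
    integrable_truncDist (hY i) measurable_const
  calc ∫ x, truncDist E (Y i x, b) ∂μ
      ≤ ∫ x, (truncDist E (Y i x, z) + truncDist E (z, b)) ∂μ :=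
        integral_mono (integrable_truncDist (hY i) measurable_const)
          (hti.add (integrable_const _)) fun x => truncDist_triangle _ _ _
    _ = ∫ x, truncDist E (Y i x, z) ∂μ + truncDist E (b, z) := by
        rw [integral_add hti (integrable_const _), truncDist_comm z b]
        simp
    _ < ε := by linarith

end Convergence

/-- A sequence tending to infinity runs through the values of a monotone one. -/
theorem exists_monotone_comp_eq {t : ℕ → ℝ≥0} (ht : Tendsto t atTop atTop) :
    ∃ s : ℕ → ℝ≥0, Monotone s ∧ Tendsto s atTop atTop ∧
      ∃ r : ℕ → ℕ, Tendsto r atTop atTop ∧ ∀ k, s (r k) = t k := by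
  -- `rank v` is the number of values of `t` below `v`
  let rank : ℝ≥0 → ℕ := fun v => (range t ∩ Iio v).ncard
  have hfin (v : ℝ≥0) : (range t ∩ Iio v).Finite := by
    have h1 : {k | t k < v}.Finite := by
      have := ht.eventually_ge_atTop v
      rw [← Nat.cofinite_eq_atTop, eventually_cofinite] at this
      simpa using this
    refine (h1.image t).subset ?_
    rintro _ ⟨⟨k, rfl⟩, hk⟩
    exact ⟨k, hk, rfl⟩
  have hmono : Monotone rank := fun v w hvw =>
    ncard_le_ncard (inter_subset_inter_right _ (Iio_subset_Iio hvw)) (hfin w)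
  have hlt {v w : ℝ≥0} (hv : v ∈ range t) (hvw : v < w) : rank v < rank w := by
    refine ncard_lt_ncard ⟨inter_subset_inter_right _ (Iio_subset_Iio hvw.le), fun h => ?_⟩ (hfin w)
    exact lt_irrefl v (h ⟨hv, hvw⟩).2
  have hunb (N : ℕ) : ∃ v ∈ range t, N ≤ rank v := by
    induction N with
    | zero => exact ⟨t 0, mem_range_self 0, Nat.zero_le _⟩
    | succ N ih =>
      obtain ⟨v, hv, hN⟩ := ih
      obtain ⟨k, hk⟩ := (ht.eventually_gt_atTop v).exists
      exact ⟨t k, mem_range_self k, hN.trans_lt (hlt hv hk)⟩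
  have hbdd (n : ℕ) : BddAbove {v ∈ range t | rank v ≤ n} := by
    obtain ⟨w, -, hw⟩ := hunb (n + 1)
    refine ⟨w, fun v hv => ?_⟩
    by_contra! hwv
    have h1 := hmono hwv.le
    have h2 := hv.2
    omega
  have hs_mono : Monotone fun n => sSup {v ∈ range t | rank v ≤ n} := fun m n hmn =>
    csSup_le_csSup' (hbdd n) fun v hv => ⟨hv.1, hv.2.trans hmn⟩
  have hs_rank (k : ℕ) : sSup {v ∈ range t | rank v ≤ rank (t k)} = t k := by
    refine IsGreatest.csSup_eq ⟨⟨mem_range_self k, le_rfl⟩, fun v hv => ?_⟩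
    by_contra! hkv
    exact (hlt (mem_range_self k) hkv).not_ge hv.2
  refine ⟨_, hs_mono, tendsto_atTop_atTop_of_monotone hs_mono fun b => ?_, fun k => rank (t k),
    tendsto_atTop.2 fun N => ?_, hs_rank⟩
  · obtain ⟨k, hk⟩ := (ht.eventually_ge_atTop b).exists
    exact ⟨rank (t k), hk.trans (hs_rank k).ge⟩
  · obtain ⟨v, -, hv⟩ := hunb N
    filter_upwards [ht.eventually_ge_atTop v] with k hk using hv.trans (hmono hk)

namespace WhiteNoiseRDS

/-! ### The random fixed point -/

variable {Ω E : Type*} [mΩ : MeasurableSpace Ω] [MetricSpace E] [mE : MeasurableSpace E]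
  {P : Measure Ω} {Φ : WhiteNoiseRDS Ω E P} {e : E}
  [IsProbabilityMeasure P] [SecondCountableTopology E] [BorelSpace E] {ρ : Measure E}

omit [SecondCountableTopology E] [BorelSpace E] in
theorem indep_past (t : ℝ≥0) : Indep (Φ.past 0) (Φ.𝓕 0 t) P := by
  have h : Φ.past 0 = ⨆ s : {s : ℝ // s ≤ 0}, Φ.𝓕 s 0 := iSup_subtype'
  rw [h]
  refine indep_iSup_of_directed_le (fun s => Φ.indep_𝓕 s 0 0 t s.2 le_rfl t.2)
    (fun s => Φ.𝓕_le s 0 s.2) (Φ.𝓕_le 0 t t.2) ?_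
  intro s u
  refine ⟨⟨min s u, (min_le_left _ _).trans s.2⟩, ?_, ?_⟩
  · exact Φ.𝓕_mono _ _ _ _ (min_le_left _ _) s.2 le_rfl
  · exact Φ.𝓕_mono _ _ _ _ (min_le_right _ _) u.2 le_rfl

/-- The random point `a` is the limit of the pullback trajectories, for every starting point in
probability, and for one starting point almost surely along a sequence of times. -/
structure IsPullbackLimit (Φ : WhiteNoiseRDS Ω E P) (e : E) (a : Ω → E) : Prop where
  measurable_past : Measurable[Φ.past 0] a
  exists_seq : ∃ τ : ℕ → ℝ≥0, Tendsto τ atTop atTop ∧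
    ∀ᵐ ω ∂P, Tendsto (fun n => Φ.pullback e (τ n) ω e) atTop (𝓝 (a ω))
  tendsto : ∀ x : E, Tendsto (fun t : ℝ≥0 => ∫ ω, truncDist E (Φ.pullback e t ω x, a ω) ∂P)
    atTop (𝓝 0)

variable {a : Ω → E}

namespace IsPullbackLimit

omit [IsProbabilityMeasure P] [SecondCountableTopology E] [BorelSpace E] in
theorem measurable (ha : Φ.IsPullbackLimit e a) : Measurable a :=
  ha.measurable_past.mono past_le le_rfl

omit [SecondCountableTopology E] in
theorem map_eq (hmix : Φ.StronglyMixing ρ) (ha : Φ.IsPullbackLimit e a) : P.map a = ρ := by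
  have := hmix.1
  have hp : IsProbabilityMeasure (P.map a) :=
    Measure.isProbabilityMeasure_map ha.measurable.aemeasurable
  obtain ⟨τ, hτ, hlim⟩ := ha.exists_seq
  refine ext_of_forall_integral_eq_of_IsFiniteMeasure fun f => ?_
  rw [integral_map ha.measurable.aemeasurable f.continuous.measurable.aestronglyMeasurable]
  have h1 : Tendsto (fun n => ∫ ω, f (Φ.pullback e (τ n) ω e) ∂P) atTop
      (𝓝 (∫ ω, f (a ω) ∂P)) := by
    refine tendsto_integral_of_dominated_convergence (fun _ => ‖f‖) (fun n => ?_)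
      (integrable_const _) (fun n => .of_forall fun _ => f.norm_coe_le_norm _) ?_
    · exact (f.continuous.measurable.comp (measurable_pullback_left _ _)).aestronglyMeasurable
    · filter_upwards [hlim] with ω hω using (f.continuous.tendsto _).comp hω
  refine tendsto_nhds_unique h1 (((hmix.tendsto_integral_flow (e := e) f e).comp hτ).congr
    fun n => ?_)
  exact (integral_comp_θ (Φ := Φ) (-(τ n : ℝ))
    (f.continuous.measurable.comp (measurable_flow_left (τ n) e))).symm

omit [SecondCountableTopology E] in
/-- The random point is independent of the future noise and has law `ρ`. -/
theorem map_freeze (hmix : Φ.StronglyMixing ρ) (ha : Φ.IsPullbackLimit e a) {R : Type*}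
    [MeasurableSpace R] (t : ℝ≥0) {G : Ω × E → R}
    (hG : @Measurable _ _ ((Φ.𝓕 0 t).prod mE) _ G) :
    P.map (fun ω => G (ω, a ω)) = (P.prod ρ).map G := by
  rw [WeakSync.map_freeze past_le (Φ.𝓕_le 0 t t.2) (indep_past t) ha.measurable_past hG,
    ha.map_eq hmix]

omit [IsProbabilityMeasure P] [SecondCountableTopology E] [BorelSpace E] in
theorem measurable_of_𝓕 {R : Type*} [MeasurableSpace R] (t : ℝ≥0) {G : Ω × E → R}
    (hG : @Measurable _ _ ((Φ.𝓕 0 t).prod mE) _ G) : Measurable G :=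
  hG.mono (sup_le_sup (MeasurableSpace.comap_mono (Φ.𝓕_le 0 t t.2)) le_rfl) le_rfl

theorem φ_ne_none (hmix : Φ.StronglyMixing ρ) (ha : Φ.IsPullbackLimit e a) (t : ℝ≥0) :
    ∀ᵐ ω ∂P, Φ.φ t ω (some (a ω)) ≠ none := by
  have := hmix.1
  have hsome : @Measurable _ _ ((Φ.𝓕 0 t).prod mE) ((Φ.𝓕 0 t).prod inferInstance)
      (fun p : Ω × E => (p.1, some p.2)) :=
    @Measurable.prodMk _ ((Φ.𝓕 0 t).prod mE) _ _ (Φ.𝓕 0 t) _ _ _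
      (@measurable_fst _ _ (Φ.𝓕 0 t) _)
      (measurable_some.comp (@measurable_snd _ _ (Φ.𝓕 0 t) _))
  have hG : @Measurable _ _ ((Φ.𝓕 0 t).prod mE) _
      (fun p : Ω × E => Φ.φ t p.1 (some p.2)) := (Φ.adapted_φ t).comp hsome
  have hGm := measurable_of_𝓕 t hG
  have h := ha.map_freeze hmix t hG
  have h1 : ∀ᵐ o ∂(P.prod ρ).map (fun p : Ω × E => Φ.φ t p.1 (some p.2)), o ≠ none := by
    rw [ae_map_iff hGm.aemeasurable measurableSet_ne_none]
    exact ae_prod_of_forall_ae (hGm measurableSet_ne_none) fun x => hmix.weaklyComplete t x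
  have hGa : Measurable fun ω => Φ.φ t ω (some (a ω)) :=
    hGm.comp (measurable_id.prodMk ha.measurable)
  rw [← h] at h1
  exact (ae_map_iff hGa.aemeasurable measurableSet_ne_none).1 h1

/-- The random point is invariant under the flow. -/
theorem flow_eq (hmix : Φ.StronglyMixing ρ) (ha : Φ.IsPullbackLimit e a) (t : ℝ≥0) :
    ∀ᵐ ω ∂P, Φ.flow e t ω (a ω) = a (Φ.θ t ω) := by
  have hwc := hmix.weaklyComplete
  obtain ⟨τ, hτ, hlim⟩ := ha.exists_seq
  have hm1 (n : ℕ) : Measurable fun ω => Φ.flow e t ω (Φ.pullback e (τ n) ω e) :=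
    (measurable_flow t).comp (measurable_id.prodMk (measurable_pullback_left _ _))
  have hm2 : Measurable fun ω => Φ.flow e t ω (a ω) :=
    (measurable_flow t).comp (measurable_id.prodMk ha.measurable)
  have hm3 : Measurable fun ω => a (Φ.θ t ω) := ha.measurable.comp (measurable_θ' t)
  have h1 : Tendsto (fun n => ∫ ω, truncDist E
      (Φ.flow e t ω (Φ.pullback e (τ n) ω e), a (Φ.θ t ω)) ∂P) atTop
      (𝓝 (∫ ω, truncDist E (Φ.flow e t ω (a ω), a (Φ.θ t ω)) ∂P)) := by
    refine tendsto_integral_of_dominated_convergence (fun _ => 1)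
      (fun n => (measurable_truncDist (hm1 n) hm3).aestronglyMeasurable)
      (integrable_const _) (fun n => .of_forall fun _ => norm_truncDist_le_one _) ?_
    filter_upwards [hlim, ha.φ_ne_none hmix t] with ω hω hne
    exact ((truncDist E).continuous.tendsto _).comp
      (((continuousAt_flow_of_ne_none hne).tendsto.comp hω).prodMk_nhds tendsto_const_nhds)
  have h2 : Tendsto (fun n => ∫ ω, truncDist E
      (Φ.flow e t ω (Φ.pullback e (τ n) ω e), a (Φ.θ t ω)) ∂P) atTop (𝓝 0) := by
    have hτt : Tendsto (fun n => t + τ n) atTop atTop :=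
      tendsto_atTop_mono (fun _ => le_add_self) hτ
    refine ((ha.tendsto e).comp hτt).congr fun n => ?_
    rw [Function.comp_apply, ← integral_comp_θ (Φ := Φ) (P := P) (t : ℝ)
      (measurable_truncDist (measurable_pullback_left _ _) ha.measurable)]
    refine integral_congr_ae ?_
    filter_upwards [(measurePreserving_θ (Φ := Φ) (-(τ n : ℝ))).quasiMeasurePreserving.ae
      (flow_add (e := e) hwc t (τ n) e)] with ω hω
    have h3 : Φ.θ (-((t + τ n : ℝ≥0) : ℝ)) (Φ.θ t ω) = Φ.θ (-(τ n : ℝ)) ω := by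
      rw [← Φ.θ_add]
      congr 1
      push_cast
      ring
    simp only [pullback, h3, hω, θ_θ_neg]
  have h0 := tendsto_nhds_unique h1 h2
  rw [integral_eq_zero_iff_of_nonneg (fun ω => truncDist_nonneg _)
    (integrable_truncDist hm2 hm3)] at h0
  filter_upwards [h0] with ω hω using truncDist_eq_zero.1 hω

/-! ### The minimal weak point attractor -/

theorem isWeakPointAttractor (hmix : Φ.StronglyMixing ρ) (ha : Φ.IsPullbackLimit e a) :
    Φ.IsWeakPointAttractor fun ω => {a ω} := by
  refine ⟨⟨fun ω => singleton_nonempty _, .of_forall fun ω => isCompact_singleton, fun x => ?_⟩,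
    fun t => ?_, fun x ε hε => ?_⟩
  · simp only [Metric.infDist_singleton]
    exact measurable_const.dist ha.measurable
  · filter_upwards [ha.φ_ne_none hmix t, ha.flow_eq hmix t] with ω h1 h2
    obtain ⟨y, hy⟩ := Option.ne_none_iff_exists'.1 h1
    rw [flow_eq_of_eq_some hy] at h2
    simp [hy, h2]
  · refine (tendsto_measure_le_edist_of_tendsto_integral
      (fun t => measurable_pullback_left (Φ := Φ) (e := e) (P := P) t x) ha.measurable
      (ha.tendsto x) hε).congr fun t => measure_congr ?_
    filter_upwards [(measurePreserving_θ (Φ := Φ) (-(t : ℝ))).quasiMeasurePreserving.ae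
      (hmix.weaklyComplete.some_flow e t x)] with ω hω
    change (ε ≤ edist _ _) = (ε ≤ _)
    rw [hω, distSet, Metric.infEDist_singleton]
    rfl

theorem ae_mem_of_isWeakPointAttractor (hmix : Φ.StronglyMixing ρ) (ha : Φ.IsPullbackLimit e a)
    {A : Ω → Set E} (hA : Φ.IsWeakPointAttractor A) : ∀ᵐ ω ∂P, a ω ∈ A ω := by
  obtain ⟨⟨-, hcomp, -⟩, -, hattr⟩ := hA
  have h1 (ε : ℝ≥0∞) (hε : 0 < ε) : ∀ᵐ ω ∂P, Metric.infEDist (a ω) (A ω) < ε + ε := by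
    have hlim := (tendsto_measure_le_edist_of_tendsto_integral
      (fun t => measurable_pullback_left (Φ := Φ) (e := e) (P := P) t e) ha.measurable
      (ha.tendsto e) hε).add (hattr e ε hε)
    rw [add_zero] at hlim
    rw [ae_iff, ← nonpos_iff_eq_zero]
    refine ge_of_tendsto hlim (.of_forall fun t => ?_)
    refine le_trans (measure_mono_ae ?_) (measure_union_le _ _)
    filter_upwards [(measurePreserving_θ (Φ := Φ) (-(t : ℝ))).quasiMeasurePreserving.ae
      (hmix.weaklyComplete.some_flow e t e)] with ω hω hω'
    by_contra hcon
    obtain ⟨h2, h3⟩ := not_or.1 hcon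
    have h2' : edist (Φ.pullback e t ω e) (a ω) < ε := not_le.1 h2
    have h3' : distSet (Φ.φ t (Φ.θ (-(t : ℝ)) ω) (some e)) (A ω) < ε := not_le.1 h3
    rw [hω] at h3'
    refine hω' (lt_of_le_of_lt Metric.infEDist_le_infEDist_add_edist
      (ENNReal.add_lt_add h3' ?_))
    rw [edist_comm]
    exact h2'
  have h2 : ∀ᵐ ω ∂P, ∀ n : ℕ,
      Metric.infEDist (a ω) (A ω) < ((n : ℝ≥0∞) + 1)⁻¹ + ((n : ℝ≥0∞) + 1)⁻¹ :=
    ae_all_iff.2 fun n => h1 _ (by simp)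
  filter_upwards [h2, hcomp] with ω hω hc
  rw [← hc.isClosed.closure_eq, Metric.mem_closure_iff_infEDist_zero, ← nonpos_iff_eq_zero]
  have hl : Tendsto (fun n : ℕ => ((n : ℝ≥0∞) + 1)⁻¹) atTop (𝓝 0) := by
    refine tendsto_of_tendsto_of_tendsto_of_le_of_le tendsto_const_nhds
      ENNReal.tendsto_inv_nat_nhds_zero (fun _ => zero_le)
      (fun n => ENNReal.inv_le_inv.2 le_self_add)
  have hl2 := hl.add hl
  rw [add_zero] at hl2
  exact ge_of_tendsto hl2 (.of_forall fun n => (hω n).le)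

theorem isMinimalWeakPointAttractor (hmix : Φ.StronglyMixing ρ) (ha : Φ.IsPullbackLimit e a) :
    Φ.IsMinimalWeakPointAttractor fun ω => {a ω} := by
  refine ⟨ha.isWeakPointAttractor hmix, fun A hA => ?_⟩
  filter_upwards [ha.ae_mem_of_isWeakPointAttractor hmix hA] with ω hω
  exact singleton_subset_iff.2 hω

/-! ### The statistical equilibrium -/

/-- The image of `ρ` under the pullback flow is the conditional law of the random point, given the
noise between the times `-t` and `0`. -/
theorem condExp_eq (hmix : Φ.StronglyMixing ρ) (ha : Φ.IsPullbackLimit e a) (t : ℝ≥0)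
    (f : E →ᵇ ℝ) :
    (fun ω => ∫ x, f (Φ.pullback e t ω x) ∂ρ) =ᵐ[P] P[fun ω => f (a ω) | Φ.𝓕 (-t) 0] := by
  have := hmix.1
  have hle : Φ.𝓕 (-t) 0 ≤ mΩ := Φ.𝓕_le _ _ (by simp)
  have hfm := f.continuous.measurable
  have hfX : @Measurable _ _ ((Φ.𝓕 (-t) 0).prod mE) _
      (Function.uncurry fun ω x => f (Φ.pullback e t ω x)) := hfm.comp (measurable_pullback_𝓕 t)
  have hNm : StronglyMeasurable[Φ.𝓕 (-t) 0] fun ω => ∫ x, f (Φ.pullback e t ω x) ∂ρ :=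
    @StronglyMeasurable.integral_prod_right _ _ _ (Φ.𝓕 (-t) 0) _ _ _ _ _ _ hfX.stronglyMeasurable
  have hNC (ω : Ω) : ‖∫ x, f (Φ.pullback e t ω x) ∂ρ‖ ≤ ‖f‖ := by
    simpa using norm_integral_le_of_norm_le_const (μ := ρ) (C := ‖f‖)
        (f := fun x => f (Φ.pullback e t ω x)) (.of_forall fun x => f.norm_coe_le_norm _)
  have hfa : Integrable (fun ω => f (a ω)) P :=
    Integrable.of_bound (hfm.comp ha.measurable).aestronglyMeasurable ‖f‖
      (.of_forall fun _ => f.norm_coe_le_norm _)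
  refine ae_eq_condExp_of_forall_setIntegral_eq hle hfa (fun s _ _ =>
    (Integrable.of_bound (hNm.mono hle).aestronglyMeasurable ‖f‖
      (.of_forall hNC)).integrableOn) (fun B hB _ => ?_) hNm.aestronglyMeasurable
  have hcomap := Φ.comap_𝓕 (-t) 0 t t.2
  rw [zero_add, add_neg_cancel] at hcomap
  obtain ⟨B', hB', rfl⟩ : MeasurableSet[(Φ.𝓕 0 t).comap (Φ.θ (-(t : ℝ)))] B := by rwa [hcomap]
  have hB'm : MeasurableSet B' := Φ.𝓕_le 0 t t.2 _ hB'
  let H : Ω × E → ℝ := fun p => B'.indicator (fun _ => 1) p.1 * f (Φ.flow e t p.1 p.2)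
  have hH𝓕 : @Measurable _ _ ((Φ.𝓕 0 t).prod mE) _ H := by
    have hone : Measurable[Φ.𝓕 0 t] (B'.indicator fun _ => (1 : ℝ)) :=
      (@measurable_const _ _ _ (Φ.𝓕 0 t) _).indicator hB'
    have hind : @Measurable _ _ ((Φ.𝓕 0 t).prod mE) _
        (fun p : Ω × E => B'.indicator (fun _ => (1 : ℝ)) p.1) :=
      hone.comp (@measurable_fst _ _ (Φ.𝓕 0 t) _)
    exact hind.mul (hfm.comp (measurable_flow_𝓕 t))
  have hH : Measurable H := measurable_of_𝓕 t hH𝓕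
  have hHC (p : Ω × E) : ‖H p‖ ≤ ‖f‖ := by
    simp only [H, norm_mul]
    have h1 : ‖B'.indicator (fun _ => (1 : ℝ)) p.1‖ ≤ 1 := by
      by_cases hp : p.1 ∈ B' <;> simp [hp]
    calc _ ≤ 1 * ‖f‖ := mul_le_mul h1 (f.norm_coe_le_norm _) (norm_nonneg _) zero_le_one
      _ = ‖f‖ := one_mul _
  have hHa : Measurable fun ω => H (ω, a ω) := hH.comp (measurable_id.prodMk ha.measurable)
  have hfreeze : ∫ ω, H (ω, a ω) ∂P = ∫ p, H p ∂(P.prod ρ) := by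
    have h := congrArg (fun m => ∫ y, id y ∂m) (ha.map_freeze hmix t hH𝓕)
    rwa [integral_map hHa.aemeasurable aestronglyMeasurable_id,
      integral_map hH.aemeasurable aestronglyMeasurable_id] at h
  have hθB := measurable_θ' (Φ := Φ) (-(t : ℝ)) hB'm
  -- after the shift by `-t` the invariant point is a function of the past, and can be frozen
  calc ∫ ω in Φ.θ (-(t : ℝ)) ⁻¹' B', ∫ x, f (Φ.pullback e t ω x) ∂ρ ∂P
      = ∫ ω, ∫ x, H (Φ.θ (-(t : ℝ)) ω, x) ∂ρ ∂P := by
        rw [← integral_indicator hθB]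
        refine integral_congr_ae (.of_forall fun ω => ?_)
        simp only [H, integral_const_mul]
        by_cases hω : Φ.θ (-(t : ℝ)) ω ∈ B' <;> simp [hω, pullback]
    _ = ∫ p, H p ∂(P.prod ρ) := by
        rw [integral_comp_θ (f := fun ω => ∫ x, H (ω, x) ∂ρ) (-(t : ℝ))
          hH.stronglyMeasurable.integral_prod_right.measurable,
          integral_prod _ (Integrable.of_bound hH.aestronglyMeasurable _ (.of_forall hHC))]
    _ = ∫ ω, H (Φ.θ (-(t : ℝ)) ω, a (Φ.θ (-(t : ℝ)) ω)) ∂P := by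
        rw [← hfreeze, ← integral_comp_θ (Φ := Φ) (-(t : ℝ)) hHa]
    _ = ∫ ω in Φ.θ (-(t : ℝ)) ⁻¹' B', f (a ω) ∂P := by
        rw [← integral_indicator hθB]
        refine integral_congr_ae ?_
        filter_upwards [(measurePreserving_θ (Φ := Φ) (-(t : ℝ))).quasiMeasurePreserving.ae
          (ha.flow_eq hmix t)] with ω hω
        rw [θ_θ_neg] at hω
        simp only [H, hω]
        by_cases hω : Φ.θ (-(t : ℝ)) ω ∈ B' <;> simp [hω]

/-- Lévy's upward theorem, for monotone sequences of times. -/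
theorem tendsto_integral_pullback_of_monotone (hmix : Φ.StronglyMixing ρ)
    (ha : Φ.IsPullbackLimit e a) {s : ℕ → ℝ≥0} (hs : Monotone s) (hs' : Tendsto s atTop atTop)
    (f : E →ᵇ ℝ) :
    ∀ᵐ ω ∂P, Tendsto (fun n => ∫ x, f (Φ.pullback e (s n) ω x) ∂ρ) atTop (𝓝 (f (a ω))) := by
  let ℱ : Filtration ℕ mΩ :=
    { seq := fun n => Φ.𝓕 (-s n) 0
      mono' := fun m n hmn => Φ.𝓕_mono _ _ _ _ (by simpa using hs hmn) (by simp) le_rfl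
      le' := fun n => Φ.𝓕_le _ _ (by simp) }
  have hsup : Φ.past 0 ≤ ⨆ n, ℱ n := by
    refine iSup₂_le fun u hu => ?_
    obtain ⟨n, hn⟩ := (hs'.eventually_ge_atTop (-u).toNNReal).exists
    refine le_trans ?_ (le_iSup (fun n => ℱ n) n)
    refine Φ.𝓕_mono _ _ _ _ ?_ hu le_rfl
    have := Real.toNNReal_le_iff_le_coe.1 hn
    linarith
  have hfa : Integrable (fun ω => f (a ω)) P :=
    Integrable.of_bound (f.continuous.measurable.comp ha.measurable).aestronglyMeasurable ‖f‖
      (.of_forall fun _ => f.norm_coe_le_norm _)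
  have hmeas : StronglyMeasurable[⨆ n, ℱ n] fun ω => f (a ω) :=
    ((f.continuous.measurable.comp ha.measurable_past).mono hsup le_rfl).stronglyMeasurable
  have hall : ∀ᵐ ω ∂P, ∀ n,
      ∫ x, f (Φ.pullback e (s n) ω x) ∂ρ = (P[fun ω => f (a ω) | Φ.𝓕 (-s n) 0]) ω :=
    ae_all_iff.2 fun n => ha.condExp_eq hmix (s n) f
  filter_upwards [hfa.tendsto_ae_condExp hmeas, hall] with ω h1 h2
  exact h1.congr fun n => (h2 n).symm

theorem tendsto_integral_pullback (hmix : Φ.StronglyMixing ρ)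
    (ha : Φ.IsPullbackLimit e a) {t : ℕ → ℝ≥0} (ht : Tendsto t atTop atTop) :
    ∀ᵐ ω ∂P, ∀ f : E →ᵇ ℝ,
      Tendsto (fun n => ∫ x, f (Φ.pullback e (t n) ω x) ∂ρ) atTop (𝓝 (f (a ω))) := by
  have := hmix.1
  have : Nonempty E := ⟨e⟩
  obtain ⟨s, hs, hs', r, hr, hrt⟩ := exists_monotone_comp_eq ht
  let g (k : ℕ) : E →ᵇ ℝ := (truncDist E).compContinuous
    ⟨fun x => (x, TopologicalSpace.denseSeq E k), Continuous.prodMk_left _⟩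
  have hall := ae_all_iff.2 fun k => ha.tendsto_integral_pullback_of_monotone hmix hs hs' (g k)
  filter_upwards [hall] with ω hω f
  refine tendsto_integral_of_forall_denseSeq
    (fun n => (measurable_pullback (t n)).comp measurable_prodMk_left) (fun k => ?_) f
  refine ((hω k).comp hr).congr fun n => ?_
  rw [Function.comp_apply, hrt]
  rfl

theorem tendsto_integral_extendZero (hmix : Φ.StronglyMixing ρ)
    (ha : Φ.IsPullbackLimit e a) {t : ℕ → ℝ≥0} (ht : Tendsto t atTop atTop) :
    ∀ᵐ ω ∂P, ∀ f : E →ᵇ ℝ,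
      Tendsto (fun k => ∫ x, extendZero f (Φ.φ (t k) (Φ.θ (-(t k : ℝ)) ω) (some x)) ∂ρ) atTop
        (𝓝 (f (a ω))) := by
  have := hmix.1
  have hm (s : ℝ≥0) : Measurable fun p : Ω × E => Φ.φ s p.1 (some p.2) :=
    Φ.measurable_φ.comp (measurable_const.prodMk
      (measurable_fst.prodMk (measurable_some.comp measurable_snd)))
  have hne (s : ℝ≥0) : ∀ᵐ ω ∂P, ∀ᵐ x ∂ρ, Φ.φ s ω (some x) ≠ none :=
    Measure.ae_ae_of_ae_prod (p := fun p : Ω × E => Φ.φ s p.1 (some p.2) ≠ none)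
      (ae_prod_of_forall_ae (hm s measurableSet_ne_none) fun x => hmix.weaklyComplete s x)
  have hne' : ∀ᵐ ω ∂P, ∀ k, ∀ᵐ x ∂ρ, Φ.φ (t k) (Φ.θ (-(t k : ℝ)) ω) (some x) ≠ none :=
    ae_all_iff.2 fun k =>
      (measurePreserving_θ (Φ := Φ) (-(t k : ℝ))).quasiMeasurePreserving.ae (hne (t k))
  filter_upwards [ha.tendsto_integral_pullback hmix ht, hne'] with ω h1 h2 f
  refine (h1 f).congr fun k => integral_congr_ae ?_
  filter_upwards [h2 k] with x hx
  obtain ⟨y, hy⟩ := Option.ne_none_iff_exists'.1 hx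
  rw [hy, extendZero, pullback, flow_eq_of_eq_some hy]

theorem isStatisticalEquilibrium_dirac (hmix : Φ.StronglyMixing ρ)
    (ha : Φ.IsPullbackLimit e a) :
    Φ.IsStatisticalEquilibrium ρ fun ω => Measure.dirac (a ω) := by
  refine ⟨fun ω => inferInstance, Measure.measurable_dirac.comp ha.measurable_past,
    fun t ht => ?_⟩
  filter_upwards [ha.tendsto_integral_extendZero hmix ht] with ω hω f
  simpa using hω f

theorem ae_eq_dirac (hmix : Φ.StronglyMixing ρ)
    (ha : Φ.IsPullbackLimit e a) {μ : Ω → Measure E} (hμ : Φ.IsStatisticalEquilibrium ρ μ) :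
    ∀ᵐ ω ∂P, μ ω = Measure.dirac (a ω) := by
  have ht : Tendsto (fun n : ℕ => (n : ℝ≥0)) atTop atTop := tendsto_natCast_atTop_atTop
  filter_upwards [ha.tendsto_integral_extendZero hmix ht, hμ.2.2 _ ht] with ω h1 h2
  have := hμ.1 ω
  refine ext_of_forall_integral_eq_of_IsFiniteMeasure fun f => ?_
  rw [tendsto_nhds_unique (h2 f) (h1 f)]
  simp

end IsPullbackLimit
end WhiteNoiseRDS

theorem support_dirac {E : Type*} [TopologicalSpace E] [T1Space E] [MeasurableSpace E]
    [OpensMeasurableSpace E] (x : E) : (Measure.dirac x).support = {x} := by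
  ext y
  rw [Measure.mem_support_iff_forall, mem_singleton_iff]
  constructor
  · intro h
    by_contra hne
    have := h {x}ᶜ (isOpen_compl_singleton.mem_nhds hne)
    rw [Measure.dirac_apply' _ (isClosed_singleton.measurableSet.compl)] at this
    simp at this
  · rintro rfl U hU
    rw [Measure.dirac_apply_of_mem (mem_of_mem_nhds hU)]
    exact one_pos

end WeakSync

theorem mainTheorem2 {Ω E : Type*} [MeasurableSpace Ω] [MetricSpace E] [CompleteSpace E]
    [TopologicalSpace.SeparableSpace E] [MeasurableSpace E] [BorelSpace E]
    (P : Measure Ω) [IsProbabilityMeasure P] (Φ : WeakSync.WhiteNoiseRDS Ω E P)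
    (ρ : Measure E) (U : Set E)
    (hrc : Φ.RightContinuous)
    (hmix : Φ.StronglyMixing ρ)
    (hstab : Φ.WeaklyAsymptoticallyStable U) (hU : 0 < ρ U)
    (hswift : Φ.PointwiseStronglySwiftTransitive)
    (hliminf : ∀ x y : E, ∀ᵐ ω ∂P,
      liminf (fun t : ℝ≥0 => WeakSync.dist' (Φ.φ t ω (some x)) (Φ.φ t ω (some y))) atTop = 0) :
    (∃ μ : Ω → Measure E, Φ.IsStatisticalEquilibrium ρ μ) ∧
    ∃ a : Ω → E, @Measurable Ω E (Φ.past 0) inferInstance a ∧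
      Φ.IsMinimalWeakPointAttractor (fun ω => {a ω}) ∧
      ∀ μ : Ω → Measure E, Φ.IsStatisticalEquilibrium ρ μ →
        ∀ᵐ ω ∂P, (μ ω).support = {a ω} := by
  have : SecondCountableTopology E := UniformSpace.secondCountable_of_separable E
  obtain ⟨e, -⟩ := hstab.2.1
  obtain ⟨a, ha1, ha2, ha3⟩ := WeakSync.WhiteNoiseRDS.exists_pullback_limit hmix
    (WeakSync.WhiteNoiseRDS.syncInMean hrc hmix hstab hswift hliminf) e
  have ha : Φ.IsPullbackLimit e a := ⟨ha1, ha2, ha3⟩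
  refine ⟨⟨_, ha.isStatisticalEquilibrium_dirac hmix⟩, a, ha1,
    ha.isMinimalWeakPointAttractor hmix, fun μ hμ => ?_⟩
  filter_upwards [ha.ae_eq_dirac hmix hμ] with ω hω
  rw [hω, WeakSync.support_dirac]
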